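/- Let $p\in\mathbb N$ and let $X=\{X(t)\}_{t\ge 0}$ be a time-inhomogeneous Markov jump process (right-continuous, piecewise constant paths with finitely many jumps in bounded intervals) on $E=\{1,\dots,p,p+1\}$, with initial distribution $(\pi,0)$, $\pi=(\pi_1,\dots,\pi_p)$, and intensity matrix function $$\Lambda(t)=\begin{pmatrix}T(t)&t(t)\\0&0\end{pmatrix},\qquad t(t)=-T(t)e,\quad e=(1,\dots,1)'.$$ Here $T(t)=\{\mu_{ij}(t)\}_{i,j\le p}$ is a sub-intensity matrix function (nonnegative off-diagonal entries, nonpositive row sums) with locally integrable entries on $[0,\infty)$. The transition probability matrices of $X$ are the product integrals $\prod_s^t(I+\Lambda(u)\,du)$, that is, the limits of the ordered products $\prod_k\bigl(I+\int_{u_k}^{u_{k+1}}\Lambda(u)\,du\bigr)$ over partitions of $[s,t]$ as the mesh tends to $0$. Write $\bar P(s,t)=\prod_s^t(I+T(u)\,du)$, let $\tau=\inf\{t\ge0: X(t)=p+1\}$ (possibly $\infty$), and let $e_i$ be the $i$-th unit vector of $\mathbb R^p$. For $0\le t\le x$ say that the state $i\le p$ is possible at time $t$ given $\tau=x$ if $e_i'\bar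 P(t,x)t(x)>0$. Then there is a regular conditional distribution of the path of $X$ given $\tau$ (on the space of jump paths with the $\sigma$-algebra generated by the coordinates), and for every version of it and almost every finite value $x$ of $\tau$ (with respect to the law of $\tau$) the following holds: $x>0$, $\pi\bar P(0,x)t(x)>0$, and the conditional process $\{X(s)\}_{0\le s<x}$ given $\tau=x$ is a time-inhomogeneous Markov jump process with values in $\{1,\dots,p\}$, with initial distribution $$\widetilde\pi_i(x)=\frac{\pi_i\,e_i'\bar P(0,x)t(x)}{\pi\bar P(0,x)t(x)}$$ and transition probabilities $$\widetilde p_{ij}(t,s|x)=\frac{e_i'\bar P(t,s)e_j\;e_j'\bar P(s,x)t(x)}{e_i'\bar P(t,x)t(x)},\qquad 0\le t\le s<x,$$ for states $i$ possible at time $t$; at each fixed time $t<x$ it is almost surely in a state possible at time $t$. Its transition intensities are $$\widetilde\mu_{ij}(t|x)=\mu_{ij}(t)\,\frac{e_j'\bar P(t,x)t(x)}{e_i'\bar P(t,x)t(x)},\quad i\neq j,\qquad \widetilde\mu_{ii}(t|x)=-\sum_{k\ne i}\widetilde\mu_{ik}(t|x),$$ in the following sense, for every $x>0$. For states $i$ possible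 at the initial time, $\widetilde p(\cdot,\cdot|x)$ is nonnegative with row sums $1$, it satisfies the Chapman–Kolmogorov equations $\widetilde p_{ij}(t,s|x)=\sum_k\widetilde p_{ik}(t,u|x)\widetilde p_{kj}(u,s|x)$, $t\le u\le s<x$, and it satisfies Kolmogorov's forward equations with intensities $\widetilde\mu$, $$\widetilde p_{ij}(t,s|x)=\delta_{ij}+\int_t^s\sum_{k}\widetilde p_{ik}(t,u|x)\,\widetilde\mu_{kj}(u|x)\,du,\qquad 0\le t\le s<x,$$ where the terms of the sum are integrable over $[t,s]$ (in both sums, a term is read as $0$ if $k$ is not possible at time $u$). Moreover $$\lim_{h\downarrow0}\frac{\widetilde p_{ij}(t,t+h|x)-\delta_{ij}}{h}=\widetilde\mu_{ij}(t|x)$$ for all $j$ and all states $i$ possible at time $t$, for Lebesgue-almost every $t\in[0,x)$ and for every $t\in[0,x)$ at which $T$ is right-continuous. -/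

import Mathlib

open Set Filter Topology MeasureTheory ProbabilityTheory
open scoped NNReal ENNReal Matrix

noncomputable section

namespace IPH

/-! ### Product integrals of matrix functions -/

/-- The increment `∫_a^b A(u) du` of a matrix function, entry by entry. -/
def increment {S : Type*} (A : ℝ → Matrix S S ℝ) (a b : ℝ) : Matrix S S ℝ :=
  Matrix.of fun i j => ∫ u in a..b, A u i j

/-- The ordered product `∏_{k<n} (I + ∫_{u k}^{u (k+1)} A)`, earlier times to the left. -/
def partitionProd {S : Type*} [Fintype S] [DecidableEq S] (A : ℝ → Matrix S S ℝ)
    (n : ℕ) (u : ℕ → ℝ) : Matrix S S ℝ :=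
  ((List.range n).map fun k => 1 + increment A (u k) (u (k + 1))).prod

/-- `M` is the product integral of `I + A(u) du` over `[s, t]`: the limit of the ordered products
over the partitions `s = u 0 ≤ u 1 ≤ … ≤ u n = t` as the mesh tends to `0`. -/
def HasProdIntegral {S : Type*} [Fintype S] [DecidableEq S] (A : ℝ → Matrix S S ℝ)
    (s t : ℝ) (M : Matrix S S ℝ) : Prop :=
  ∀ ε : ℝ, 0 < ε → ∃ δ : ℝ, 0 < δ ∧ ∀ (n : ℕ) (u : ℕ → ℝ), Monotone u → u 0 = s → u n = t →
    (∀ k < n, u (k + 1) - u k < δ) → ∀ i j, |partitionProd A n u i j - M i j| < ε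

/-- Product integrals over `[s, t]` with `s ≤ t` are unique. -/
theorem HasProdIntegral.unique {S : Type*} [Fintype S] [DecidableEq S] {A : ℝ → Matrix S S ℝ}
    {s t : ℝ} {M M' : Matrix S S ℝ} (hst : s ≤ t) (h : HasProdIntegral A s t M)
    (h' : HasProdIntegral A s t M') : M = M' := by
  ext i j
  by_contra hne
  have hpos : 0 < |M i j - M' i j| / 2 := by
    have := abs_pos.mpr (sub_ne_zero.mpr hne)
    linarith
  obtain ⟨δ, hδ, H⟩ := h _ hpos
  obtain ⟨δ', hδ', H'⟩ := h' _ hpos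
  have hm : 0 < min δ δ' := lt_min hδ hδ'
  obtain ⟨n, hn⟩ := exists_nat_gt ((t - s) / min δ δ')
  have hn' : t - s < n * min δ δ' := by
    rwa [div_lt_iff₀ hm] at hn
  -- the partition with step `min δ δ' / 2`, stopped at `t`
  set η := min δ δ' / 2 with hη
  have hη0 : 0 < η := by positivity
  let u : ℕ → ℝ := fun k => min (s + k * η) t
  have hu : Monotone u := by
    intro a b hab
    have : (a : ℝ) ≤ b := by exact_mod_cast hab
    exact min_le_min (by nlinarith) le_rfl
  have hu0 : u 0 = s := by simp [u, hst]
  have hun : u (2 * n) = t := by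
    simp only [u]
    apply min_eq_right
    push_cast
    rw [hη]
    linarith
  have hmesh : ∀ k, u (k + 1) - u k < min δ δ' := by
    intro k
    have h1 : u (k + 1) ≤ u k + η := by
      simp only [u]
      rw [← min_add_add_right]
      refine min_le_min ?_ (by linarith)
      push_cast
      linarith
    have h2 : η < min δ δ' := by rw [hη]; linarith
    linarith
  have e1 := H (2 * n) u hu hu0 hun (fun k _ => (hmesh k).trans_le (min_le_left _ _)) i j
  have e2 := H' (2 * n) u hu hu0 hun (fun k _ => (hmesh k).trans_le (min_le_right _ _)) i j
  rw [abs_sub_comm] at e1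
  have := abs_sub_le (M i j) (partitionProd A (2 * n) u i j) (M' i j)
  linarith

open Classical in
/-- The product integral of `I + A(u) du` over `[s, t]` (only used for `s ≤ t`). -/
def prodIntegral {S : Type*} [Fintype S] [DecidableEq S] (A : ℝ → Matrix S S ℝ)
    (s t : ℝ) : Matrix S S ℝ :=
  if h : ∃ M, HasProdIntegral A s t M then h.choose else 0

/-! ### Jump paths and Markov jump processes -/

/-- A jump path on the time interval `[0, b)`: right-continuous for the discrete topology on the
state space, with left limits.  Such a path has finitely many jumps in each compact subinterval. -/
def IsJumpPath {E : Type*} (b : ℝ≥0∞) (f : ℝ≥0 → E) : Prop :=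
  ∀ t : ℝ≥0, (t : ℝ≥0∞) < b →
    (∀ᶠ u in 𝓝[≥] t, f u = f t) ∧ (∃ e : E, ∀ᶠ u in 𝓝[<] t, f u = e)

/-- The space of jump paths on `[0, ∞)`, with the σ-algebra generated by the coordinates. -/
def JumpPath (E : Type*) : Type _ := {f : ℝ≥0 → E // IsJumpPath ⊤ f}

instance {E : Type*} [MeasurableSpace E] : MeasurableSpace (JumpPath E) :=
  inferInstanceAs (MeasurableSpace {f : ℝ≥0 → E // IsJumpPath ⊤ f})

/-- The coordinate process on the space of jump paths. -/
def coord {E : Type*} (t : ℝ≥0) (f : JumpPath E) : E := f.1 t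

/-- The σ-algebra generated by the values of the process up to time `s`. -/
abbrev pastSigma {Ω E : Type*} [MeasurableSpace E] (X : ℝ≥0 → Ω → E) (s : ℝ≥0) :
    MeasurableSpace Ω :=
  ⨆ u : ℝ≥0, ⨆ _ : u ≤ s, MeasurableSpace.comap (X u) inferInstance

/-- Under `P`, the `E`-valued process `X`, on the time interval `[0, b)`, is a time-inhomogeneous
Markov jump process taking values in the finite state space `S` (viewed inside `E` through `ι`),
with initial distribution `ν` and transition probabilities `Q`. -/
structure IsMarkovJumpProcess {Ω E S : Type*} [MeasurableSpace Ω] [MeasurableSpace E] [Fintype S]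
    (P : Measure Ω) (b : ℝ≥0∞) (X : ℝ≥0 → Ω → E) (ι : S → E)
    (ν : S → ℝ) (Q : ℝ → ℝ → Matrix S S ℝ) : Prop where
  measurable : ∀ t : ℝ≥0, (t : ℝ≥0∞) < b → Measurable (X t)
  paths : ∀ ω, IsJumpPath b (fun t => X t ω)
  states : ∀ᵐ ω ∂P, ∀ t : ℝ≥0, (t : ℝ≥0∞) < b → X t ω ∈ range ι
  initial : ∀ i, P.real {ω | X 0 ω = ι i} = ν i
  markov : ∀ s t : ℝ≥0, s ≤ t → (t : ℝ≥0∞) < b → ∀ j,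
    P[{ω | X t ω = ι j}.indicator (fun _ => (1 : ℝ)) | pastSigma X s] =ᵐ[P]
      fun ω => ∑ i, {ω | X s ω = ι i}.indicator (fun _ => Q s t i j) ω

/-- `κ` is a regular conditional distribution of the random element `Z` given `Y`. -/
def IsRegularCondDistrib {Ω A B : Type*} [MeasurableSpace Ω] [MeasurableSpace A]
    [MeasurableSpace B] (P : Measure Ω) (Z : Ω → B) (Y : Ω → A) (κ : Kernel A B) : Prop :=
  IsMarkovKernel κ ∧ P.map (fun ω => (Y ω, Z ω)) = (P.map Y) ⊗ₘ κ

/-- `Q` is a transition function on the time interval `[0, b)`, driven by the intensity matrices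
`M` through Kolmogorov's forward equations (in integrated form); only the rows of the states in
`A s`, those that can be occupied at time `s`, are constrained. -/
structure IsTransitionFunction {S : Type*} [Fintype S] [DecidableEq S]
    (b : ℝ) (A : ℝ → Set S) (Q : ℝ → ℝ → Matrix S S ℝ) (M : ℝ → Matrix S S ℝ) : Prop where
  nonneg : ∀ s t, 0 ≤ s → s ≤ t → t < b → ∀ i ∈ A s, ∀ j, 0 ≤ Q s t i j
  row_sum : ∀ s t, 0 ≤ s → s ≤ t → t < b → ∀ i ∈ A s, ∑ j, Q s t i j = 1
  chapman_kolmogorov : ∀ s u t, 0 ≤ s → s ≤ u → u ≤ t → t < b → ∀ i ∈ A s, ∀ j,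
    Q s t i j = ∑ k, Q s u i k * Q u t k j
  forward_integrable : ∀ s t, 0 ≤ s → s ≤ t → t < b → ∀ i ∈ A s, ∀ k j,
    IntervalIntegrable (fun u => Q s u i k * M u k j) volume s t
  forward : ∀ s t, 0 ≤ s → s ≤ t → t < b → ∀ i ∈ A s, ∀ j,
    Q s t i j = (1 : Matrix S S ℝ) i j + ∫ u in s..t, ∑ k, Q s u i k * M u k j

/-- The transition function `Q` has infinitesimal transition rate `m` from `i` to `j` at time `t`:
`lim_{h ↓ 0} (Q(t, t+h)_{ij} - δ_{ij}) / h = m`. -/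
def HasTransitionRate {S : Type*} [DecidableEq S] (Q : ℝ → ℝ → Matrix S S ℝ)
    (t : ℝ) (i j : S) (m : ℝ) : Prop :=
  Tendsto (fun h : ℝ => (Q t (t + h) i j - (1 : Matrix S S ℝ) i j) / h) (𝓝[>] 0) (𝓝 m)

/-! ### Inhomogeneous phase-type distributions

The state space is `Fin p ⊕ Unit`: the transient states `Sum.inl i`, and the absorbing state
`Sum.inr ()`. -/

/-- Sub-intensity matrix functions on `[0, ∞)`, with locally integrable entries. -/
structure IsSubIntensity {p : ℕ} (T : ℝ → Matrix (Fin p) (Fin p) ℝ) : Prop where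
  offDiag_nonneg : ∀ t, 0 ≤ t → ∀ i j, i ≠ j → 0 ≤ T t i j
  row_sum_nonpos : ∀ t, 0 ≤ t → ∀ i, ∑ j, T t i j ≤ 0
  integrable : ∀ t, 0 ≤ t → ∀ i j, IntervalIntegrable (fun u => T u i j) volume 0 t

/-- The vector `t(x) = -T(x) e` of rates of absorption. -/
def exitRate {p : ℕ} (T : ℝ → Matrix (Fin p) (Fin p) ℝ) (x : ℝ) : Fin p → ℝ :=
  fun i => -∑ j, T x i j

/-- The full intensity matrix, with blocks `T(t)`, `t(t)`, `0`, `0`. -/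
def fullIntensity {p : ℕ} (T : ℝ → Matrix (Fin p) (Fin p) ℝ) (t : ℝ) :
    Matrix (Fin p ⊕ Unit) (Fin p ⊕ Unit) ℝ :=
  Matrix.fromBlocks (T t) (Matrix.of fun i _ => exitRate T t i) 0 0

/-- The time until absorption, `∞` if there is no absorption. -/
def absorptionTime {Ω : Type*} {p : ℕ} (X : ℝ≥0 → Ω → Fin p ⊕ Unit) (ω : Ω) : ℝ≥0∞ :=
  sInf {a : ℝ≥0∞ | ∃ t : ℝ≥0, a = t ∧ X t ω = Sum.inr ()}

/-- The vector `P̄(t, x) t(x)`, where `P̄` is the product integral of `T`. -/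
def absorbDensity {p : ℕ} (T : ℝ → Matrix (Fin p) (Fin p) ℝ) (x t : ℝ) : Fin p → ℝ :=
  prodIntegral T t x *ᵥ exitRate T x

/-- The number `π P̄(0, x) t(x)`. -/
def iphDensity {p : ℕ} (π : Fin p → ℝ) (T : ℝ → Matrix (Fin p) (Fin p) ℝ) (x : ℝ) : ℝ :=
  π ⬝ᵥ absorbDensity T x 0

/-- The conditional initial distribution, given absorption at time `x`. -/
def condInitial {p : ℕ} (π : Fin p → ℝ) (T : ℝ → Matrix (Fin p) (Fin p) ℝ) (x : ℝ) :
    Fin p → ℝ :=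
  fun i => π i * absorbDensity T x 0 i / iphDensity π T x

/-- The conditional transition probabilities from time `t` to time `s`, given absorption at time
`x`. -/
def condTransition {p : ℕ} (T : ℝ → Matrix (Fin p) (Fin p) ℝ) (x t s : ℝ) :
    Matrix (Fin p) (Fin p) ℝ :=
  Matrix.of fun i j =>
    prodIntegral T t s i j * absorbDensity T x s j / absorbDensity T x t i

/-- The conditional intensity matrix at time `t`, given absorption at time `x`; the rates are off
the diagonal, and the diagonal makes the row sums vanish. -/
def condIntensity {p : ℕ} (T : ℝ → Matrix (Fin p) (Fin p) ℝ) (x t : ℝ) :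
    Matrix (Fin p) (Fin p) ℝ :=
  Matrix.of fun i j =>
    if i = j then
      -∑ k ∈ Finset.univ.erase i, T t i k * (absorbDensity T x t k / absorbDensity T x t i)
    else T t i j * (absorbDensity T x t j / absorbDensity T x t i)

/-- The transient states from which absorption at time `x` is possible at time `t`:
`e_i' P̄(t, x) t(x) > 0`. -/
def possibleStates {p : ℕ} (T : ℝ → Matrix (Fin p) (Fin p) ℝ) (x t : ℝ) : Set (Fin p) :=
  {i | 0 < absorbDensity T x t i}

end IPH

end

/-!
Conditioning the jump process on its absorption time `τ` is a Doob transform. The proof has three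
layers.

*Product integrals.* Let `Y` and `Z` solve `Y' = Y A` and `Z' = -A Z` with value `1` at time `0`;
`Y` is the sum of the Peano–Baker series, whose terms are bounded by `(∫ |A|) ^ n / n!`, and `Z` is
obtained from it by transposition. Since `Y Z` has derivative zero almost everywhere, `Y Z = 1`, so
`evol A s t = Z(s) Y(t)` is an evolution family. It differs from `1 + ∫_a^b A` by
`O((∫_a^b |A|) ^ 2)`, so a discrete Gronwall inequality shows that the ordered products converge to it
(`hasProdIntegral_evol`). Every analytic property of product integrals used here (continuity,
Chapman–Kolmogorov, forward and backward equations, almost everywhere differentiability) is read off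
from `Z(s) Y(t)`, while signs and the block structure are inherited from the ordered products.

*The transform.* The function `d(u) = P̄(u, x) t(x)` solves the backward equation `d' = -T d`, and the
conditional transition probabilities are `P̄(t, s)_ij d_j(s) / d_i(t)`. Chapman–Kolmogorov and the
forward equation follow from the product rule, once the states with `d_k(u) = 0` are shown not to
contribute: there the nonnegative function `d_k` has a minimum, so its derivative vanishes for almost
every such `u`, and this derivative is, up to its sign, a sum of the nonnegative terms
`μ_kl(u) d_l(u)`, `l ≠ k` (`ae_rate_mul_backward_eq_zero`).

*Disintegration.* The space of jump paths embeds, through the values along a dense sequence of times,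
as a measurable set into a countable product (`measurableEmbedding_sample`); hence it is standard
Borel and conditional distributions `κ` exist. By the Markov property, on an event of the form
`A ∩ {X_s = i}` with `A` in the past of `s`, the law of `τ` on `(s, ∞)` has the density
`P(A ∩ {X_s = i}) e_i' P̄(s, x) t(x)` (`IsPathLaw.absorbedLaw_eq`). Comparing with the disintegration
gives, for almost every `x`, the identity
`(π P̄(0, x) t(x)) κ_x(A ∩ {X_s = i}) = (e_i' P̄(s, x) t(x)) P(A ∩ {X_s = i})`,
first for countably many `s` and `A`, then for all `A` by a `π`-`λ` argument and for all `s < x` by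
right-continuity (`ae_density_mul_kernel`). The conditional Markov property is an algebraic
consequence of this identity (`IsDoobLaw.measureReal_inter`).
-/

namespace IPH

/-! ### Locally absolutely continuous functions -/

/-- Integrability on every bounded interval of the line. -/
abbrev LocInt (f : ℝ → ℝ) : Prop := ∀ a b : ℝ, IntervalIntegrable f volume a b

theorem LocInt.mul_continuous {f g : ℝ → ℝ} (hf : LocInt f) (hg : Continuous g) :
    LocInt fun u => f u * g u :=
  fun a b => (hf a b).mul_continuousOn hg.continuousOn

theorem LocInt.continuous_mul {f g : ℝ → ℝ} (hf : Continuous f) (hg : LocInt g) :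
    LocInt fun u => f u * g u :=
  fun a b => (hg a b).continuousOn_mul hf.continuousOn

theorem LocInt.sum {ι : Type*} {s : Finset ι} {f : ι → ℝ → ℝ} (hf : ∀ i ∈ s, LocInt (f i)) :
    LocInt fun u => ∑ i ∈ s, f i u := by
  intro a b
  simpa only [Finset.sum_fn] using IntervalIntegrable.sum s fun i hi => hf i hi a b

/-- `f` is locally absolutely continuous and `f'` is its derivative almost everywhere. -/
structure HasAEDeriv (f f' : ℝ → ℝ) : Prop where
  ac : ∀ a b, AbsolutelyContinuousOnInterval f a b
  deriv : ∀ᵐ u, HasDerivAt f (f' u) u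

namespace HasAEDeriv

variable {f f' g g' : ℝ → ℝ}

theorem continuous (h : HasAEDeriv f f') : Continuous f := by
  rw [continuous_iff_continuousAt]
  intro t
  have := (h.ac (t - 1) (t + 1)).continuousOn
  rw [uIcc_of_le (by linarith)] at this
  exact this.continuousAt (Icc_mem_nhds (by linarith) (by linarith))

theorem ae_deriv_eq (h : HasAEDeriv f f') : ∀ᵐ u, _root_.deriv f u = f' u := by
  filter_upwards [h.deriv] with u hu using hu.deriv

theorem locInt (h : HasAEDeriv f f') : LocInt f' := fun a b =>
  (h.ac a b).intervalIntegrable_deriv.congr_ae (ae_restrict_of_ae h.ae_deriv_eq)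

theorem integral_eq (h : HasAEDeriv f f') (a b : ℝ) : ∫ u in a..b, f' u = f b - f a := by
  rw [← (h.ac a b).integral_deriv_eq_sub]
  apply intervalIntegral.integral_congr_ae
  filter_upwards [h.ae_deriv_eq] with u hu _ using hu.symm

theorem congr_ae (h : HasAEDeriv f f') (hg : ∀ᵐ u, f' u = g' u) : HasAEDeriv f g' :=
  ⟨h.ac, by filter_upwards [h.deriv, hg] with u hu hgu using hgu ▸ hu⟩

theorem congr_deriv (h : HasAEDeriv f f') (hg : ∀ u, f' u = g' u) : HasAEDeriv f g' :=
  h.congr_ae (ae_of_all _ hg)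

theorem const (c : ℝ) : HasAEDeriv (fun _ => c) fun _ => 0 where
  ac _ _ := (contDiff_const (n := 1)).contDiffOn.absolutelyContinuousOnInterval
  deriv := ae_of_all _ fun u => hasDerivAt_const u c

theorem add (hf : HasAEDeriv f f') (hg : HasAEDeriv g g') :
    HasAEDeriv (fun u => f u + g u) fun u => f' u + g' u where
  ac a b := (hf.ac a b).add (hg.ac a b)
  deriv := by filter_upwards [hf.deriv, hg.deriv] with u hu hu' using hu.add hu'

theorem mul (hf : HasAEDeriv f f') (hg : HasAEDeriv g g') :
    HasAEDeriv (fun u => f u * g u) fun u => f' u * g u + f u * g' u where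
  ac a b := (hf.ac a b).mul (hg.ac a b)
  deriv := by filter_upwards [hf.deriv, hg.deriv] with u hu hu' using hu.mul hu'

theorem mul_const (hf : HasAEDeriv f f') (c : ℝ) :
    HasAEDeriv (fun u => f u * c) fun u => f' u * c :=
  (hf.mul (const c)).congr_deriv fun u => by simp

theorem sum {ι : Type*} {s : Finset ι} {f f' : ι → ℝ → ℝ}
    (h : ∀ i ∈ s, HasAEDeriv (f i) (f' i)) :
    HasAEDeriv (fun u => ∑ i ∈ s, f i u) fun u => ∑ i ∈ s, f' i u := by
  classical
  induction s using Finset.induction_on with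
  | empty => simpa using const 0
  | insert i s his ih =>
    simp only [Finset.sum_insert his]
    exact (h i (by simp)).add (ih fun j hj => h j (by simp [hj]))

/-- Lebesgue's differentiation theorem: the primitives of a locally integrable function are locally
absolutely continuous. -/
theorem of_integral (hg : LocInt g) (c : ℝ) :
    HasAEDeriv (fun t => c + ∫ u in (0 : ℝ)..t, g u) g := by
  have h0 : HasAEDeriv (fun t => ∫ u in (0 : ℝ)..t, g u) g := by
    refine ⟨fun a b => ?_, ?_⟩
    · refine ((hg (min a 0 ⊓ b) (max a 0 ⊔ b)).absolutelyContinuousOnInterval_intervalIntegral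
        (c := 0) ?_).mono ?_
      · rw [uIcc_of_le (by simp)]
        simp
      · rw [uIcc_of_le (a := min a 0 ⊓ b) (by simp)]
        rw [uIcc]
        exact Icc_subset_Icc (le_inf (inf_le_left.trans inf_le_left) inf_le_right)
          (sup_le (le_sup_left.trans le_sup_left) le_sup_right)
    · have hL : LocallyIntegrable g volume := by
        intro t
        refine ⟨Ioc (t - 1) (t + 1), Ioc_mem_nhds (by linarith) (by linarith), ?_⟩
        exact (intervalIntegrable_iff_integrableOn_Ioc_of_le (by linarith)).1 (hg _ _)
      filter_upwards [LocallyIntegrable.ae_hasDerivAt_integral hL] with u hu using hu 0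
  exact ((const c).add h0).congr_deriv fun u => by simp

/-- At points where the almost-everywhere derivative is right-continuous it is a right derivative. -/
theorem hasDerivWithinAt {f f' : ℝ → ℝ} (h : HasAEDeriv f f') {t : ℝ}
    (hc : ContinuousWithinAt f' (Ici t) t) : HasDerivWithinAt f (f' t) (Ici t) t := by
  have hf : f = fun u => f 0 + ∫ v in (0 : ℝ)..u, f' v := by
    ext u
    rw [h.integral_eq]
    ring
  rw [hf]
  refine HasDerivWithinAt.const_add _ ?_
  refine intervalIntegral.integral_hasDerivWithinAt_right (h.locInt 0 t) (t := Ioi t) ?_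
    (hc.mono Ioi_subset_Ici_self)
  exact ⟨Ioc t (t + 1), Ioc_mem_nhdsGT (by linarith), (h.locInt t (t + 1)).1.aestronglyMeasurable⟩

/-- The chain rule for powers. -/
theorem pow (hf : HasAEDeriv f f') (n : ℕ) :
    HasAEDeriv (fun u => f u ^ (n + 1)) fun u => (n + 1) * f u ^ n * f' u := by
  induction n with
  | zero => simpa using hf
  | succ n ih =>
    have := ih.mul hf
    simp only [← pow_succ] at this
    refine this.congr_deriv fun u => ?_
    push_cast
    ring

/-- A locally absolutely continuous function with vanishing derivative is constant. -/
theorem eq_of_deriv_zero (hf : HasAEDeriv f f') (h0 : ∀ u, f' u = 0) (a b : ℝ) : f a = f b := by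
  have := hf.integral_eq b a
  simp only [h0, intervalIntegral.integral_zero] at this
  linarith

end HasAEDeriv

/-! ### The linear matrix equations `Y' = Y A` and `Z' = -A Z` -/

section Evolution

variable {S : Type*}

variable {A : ℝ → Matrix S S ℝ}

theorem locInt_neg_transpose (hA : ∀ i j, LocInt fun u => A u i j) (i j : S) :
    LocInt fun u => (-(A u)ᵀ) i j :=
  fun a b => (hA j i a b).neg

variable [Fintype S]

/-- The sum of the absolute values of the entries, the norm used in all estimates. -/
def entrySum (M : Matrix S S ℝ) : ℝ := ∑ i, ∑ j, |M i j|

theorem entrySum_nonneg (M : Matrix S S ℝ) : 0 ≤ entrySum M :=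
  Finset.sum_nonneg fun _ _ => Finset.sum_nonneg fun _ _ => abs_nonneg _

theorem abs_le_entrySum (M : Matrix S S ℝ) (i j : S) : |M i j| ≤ entrySum M :=
  (Finset.single_le_sum (f := fun j => |M i j|) (fun _ _ => abs_nonneg _)
    (Finset.mem_univ j)).trans
  (Finset.single_le_sum (f := fun i => ∑ j, |M i j|)
    (fun _ _ => Finset.sum_nonneg fun _ _ => abs_nonneg _) (Finset.mem_univ i))

theorem sum_col_le_entrySum (M : Matrix S S ℝ) (j : S) : ∑ k, |M k j| ≤ entrySum M :=
  Finset.sum_le_sum fun k _ =>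
    Finset.single_le_sum (f := fun j => |M k j|) (fun _ _ => abs_nonneg _) (Finset.mem_univ j)

theorem abs_mul_apply_le {M : Matrix S S ℝ} {c : ℝ} (hM : ∀ i j, |M i j| ≤ c) (N : Matrix S S ℝ)
    (i j : S) : |(M * N) i j| ≤ c * entrySum N := by
  have hc : 0 ≤ c := (abs_nonneg _).trans (hM i j)
  rw [Matrix.mul_apply]
  calc |∑ k, M i k * N k j| ≤ ∑ k, |M i k * N k j| := Finset.abs_sum_le_sum_abs _ _
    _ ≤ ∑ k, c * |N k j| := by
        refine Finset.sum_le_sum fun k _ => ?_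
        rw [abs_mul]
        exact mul_le_mul_of_nonneg_right (hM i k) (abs_nonneg _)
    _ = c * ∑ k, |N k j| := by rw [Finset.mul_sum]
    _ ≤ c * entrySum N := mul_le_mul_of_nonneg_left (sum_col_le_entrySum N j) hc

theorem locInt_entrySum (hA : ∀ i j, LocInt fun u => A u i j) : LocInt fun u => entrySum (A u) :=
  LocInt.sum fun i _ => LocInt.sum fun j _ => fun a b => (hA i j a b).abs

theorem hasAEDeriv_mass (hA : ∀ i j, LocInt fun u => A u i j) :
    HasAEDeriv (fun t => ∫ u in (0 : ℝ)..t, entrySum (A u)) fun u => entrySum (A u) := by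
  simpa using HasAEDeriv.of_integral (locInt_entrySum hA) 0

theorem abs_mass_le {R t : ℝ} (hA : ∀ i j, LocInt fun u => A u i j) (ht : t ∈ Icc (-R) R) :
    |∫ u in (0 : ℝ)..t, entrySum (A u)| ≤ ∫ u in (-R)..R, entrySum (A u) := by
  have hR : -R ≤ R := ht.1.trans ht.2
  have h := locInt_entrySum hA
  rw [intervalIntegral.abs_intervalIntegral_eq,
    abs_of_nonneg (integral_nonneg fun _ => entrySum_nonneg _),
    intervalIntegral.integral_of_le hR]
  refine setIntegral_mono_set
    ((intervalIntegrable_iff_integrableOn_Ioc_of_le hR).1 (h _ _))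
    (ae_of_all _ fun _ => entrySum_nonneg _) (LE.le.eventuallyLE ?_)
  have := ht.1
  have := ht.2
  exact Ioc_subset_Ioc (le_min (by linarith) (by linarith)) (max_le (by linarith) (by linarith))

variable [DecidableEq S]

/-- The iterated integrals of the Peano–Baker series. -/
noncomputable def peano (A : ℝ → Matrix S S ℝ) : ℕ → ℝ → Matrix S S ℝ
  | 0, _ => 1
  | n + 1, t => Matrix.of fun i j => ∫ u in (0 : ℝ)..t, (peano A n u * A u) i j

/-- The sum of the Peano–Baker series: the solution of `Y' = Y A`, `Y 0 = 1`. -/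
noncomputable def rightSol (A : ℝ → Matrix S S ℝ) (t : ℝ) : Matrix S S ℝ :=
  Matrix.of fun i j => ∑' n, peano A n t i j

/-- The solution of `Z' = -A Z`, `Z 0 = 1`, obtained from `rightSol` by transposition. -/
noncomputable def leftSol (A : ℝ → Matrix S S ℝ) (t : ℝ) : Matrix S S ℝ :=
  (rightSol (fun u => -(A u)ᵀ) t)ᵀ

theorem peano_continuous (hA : ∀ i j, LocInt fun u => A u i j) (n : ℕ) (i j : S) :
    Continuous fun t => peano A n t i j := by
  induction n generalizing i j with
  | zero => exact continuous_const
  | succ n ih =>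
    have : LocInt fun u => (peano A n u * A u) i j := by
      simp only [Matrix.mul_apply]
      exact LocInt.sum fun k _ => LocInt.continuous_mul (ih i k) (hA k j)
    exact intervalIntegral.continuous_primitive this 0

theorem locInt_peano_mul (hA : ∀ i j, LocInt fun u => A u i j) (n : ℕ) (i j : S) :
    LocInt fun u => (peano A n u * A u) i j := by
  simp only [Matrix.mul_apply]
  exact LocInt.sum fun k _ => LocInt.continuous_mul (peano_continuous hA n i k) (hA k j)

/-- The terms of the Peano–Baker series are dominated by those of an exponential series. -/
theorem abs_peano_le (hA : ∀ i j, LocInt fun u => A u i j) (n : ℕ) (t : ℝ) (i j : S) :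
    |peano A n t i j| ≤ |∫ u in (0 : ℝ)..t, entrySum (A u)| ^ n / n.factorial := by
  induction n generalizing t i j with
  | zero =>
    simp only [peano, Matrix.one_apply, pow_zero, Nat.factorial_zero, Nat.cast_one, div_one]
    split_ifs <;> simp
  | succ n ih =>
    set α : ℝ → ℝ := fun t => ∫ u in (0 : ℝ)..t, entrySum (A u) with hα
    have hd := hasAEDeriv_mass hA
    -- `α` has a constant sign `ε` between `0` and `t`
    obtain ⟨ε, hε, hs⟩ : ∃ ε : ℝ, |ε| = 1 ∧ ∀ u ∈ uIoc 0 t, |α u| = ε * α u := by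
      rcases le_total 0 t with ht | ht
      · refine ⟨1, by simp, fun u hu => ?_⟩
        rw [uIoc_of_le ht] at hu
        rw [one_mul, abs_of_nonneg]
        exact intervalIntegral.integral_nonneg hu.1.le fun _ _ => entrySum_nonneg _
      · refine ⟨-1, by simp, fun u hu => ?_⟩
        rw [uIoc_of_ge ht] at hu
        rw [neg_one_mul, abs_of_nonpos]
        simp only [hα]
        rw [intervalIntegral.integral_symm, neg_nonpos]
        exact intervalIntegral.integral_nonneg hu.2 fun _ _ => entrySum_nonneg _
    have hpow := (hd.pow n).integral_eq 0 t
    simp only [intervalIntegral.integral_same, ne_eq, Nat.add_eq_zero_iff, one_ne_zero, and_false,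
      not_false_eq_true, zero_pow, sub_zero] at hpow
    have hfac : (0 : ℝ) < ((n + 1).factorial : ℝ) := by positivity
    calc |peano A (n + 1) t i j| = |∫ u in (0 : ℝ)..t, (peano A n u * A u) i j| := rfl
      _ ≤ |∫ u in (0 : ℝ)..t,
            ε ^ n / (n + 1).factorial * ((n + 1) * α u ^ n * entrySum (A u))| := by
          refine intervalIntegral.norm_integral_le_abs_of_norm_le (E := ℝ) (μ := volume) ?_
            (((hd.pow n).locInt 0 t).const_mul _)
          filter_upwards [ae_restrict_mem measurableSet_uIoc] with u hu
          refine (abs_mul_apply_le (ih u) (A u) i j).trans (le_of_eq ?_)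
          have := hs u hu
          simp only [hα] at this ⊢
          rw [this, Nat.factorial_succ]
          have : (n.factorial : ℝ) ≠ 0 := by positivity
          push_cast
          field_simp
          ring
      _ = |α t| ^ (n + 1) / (n + 1).factorial := by
          rw [intervalIntegral.integral_const_mul, hpow, abs_mul, abs_div, abs_pow, hε, one_pow,
            abs_pow, abs_of_pos hfac]
          simp only [hα]
          ring

theorem hasSum_rightSol (hA : ∀ i j, LocInt fun u => A u i j) (t : ℝ) (i j : S) :
    HasSum (fun n => peano A n t i j) (rightSol A t i j) :=
  (Summable.of_norm_bounded (Real.summable_pow_div_factorial _)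
    fun n => abs_peano_le hA n t i j).hasSum

theorem continuous_rightSol (hA : ∀ i j, LocInt fun u => A u i j) (i j : S) :
    Continuous fun t => rightSol A t i j := by
  rw [continuous_iff_continuousAt]
  intro t
  have hmem : Icc (-(|t| + 1)) (|t| + 1) ∈ 𝓝 t :=
    Icc_mem_nhds (by linarith [neg_abs_le t]) (by linarith [le_abs_self t])
  refine ContinuousOn.continuousAt ?_ hmem
  refine continuousOn_tsum (fun n => (peano_continuous hA n i j).continuousOn)
    (Real.summable_pow_div_factorial (∫ u in (-(|t| + 1))..(|t| + 1), entrySum (A u))) ?_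
  intro n u hu
  refine (abs_peano_le hA n u i j).trans ?_
  gcongr
  exact abs_mass_le hA hu

theorem rightSol_eq_integral (hA : ∀ i j, LocInt fun u => A u i j) (t : ℝ) (i j : S) :
    rightSol A t i j = (1 : Matrix S S ℝ) i j + ∫ u in (0 : ℝ)..t, (rightSol A u * A u) i j := by
  have h1 : HasSum (fun n => peano A (n + 1) t i j)
      (∫ u in (0 : ℝ)..t, (rightSol A u * A u) i j) := by
    set c := ∫ u in (-|t|)..|t|, entrySum (A u)
    refine intervalIntegral.hasSum_integral_of_dominated_convergence
      (fun n u => c ^ n / n.factorial * entrySum (A u)) (fun n => ?_) (fun n => ?_) ?_ ?_ ?_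
    · exact (locInt_peano_mul hA n i j 0 t).def'.aestronglyMeasurable
    · refine ae_of_all _ fun u hu => abs_mul_apply_le (fun i j => ?_) _ _ _
      refine (abs_peano_le hA n u i j).trans ?_
      gcongr
      refine abs_mass_le hA ?_
      rcases le_total 0 t with ht | ht
      · rw [uIoc_of_le ht] at hu
        rw [abs_of_nonneg ht]
        exact ⟨by linarith [hu.1], hu.2⟩
      · rw [uIoc_of_ge ht] at hu
        rw [abs_of_nonpos ht]
        exact ⟨by linarith [hu.1], by linarith [hu.2]⟩
    · exact ae_of_all _ fun u _ => (Real.summable_pow_div_factorial c).mul_right _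
    · simp only [tsum_mul_right]
      exact (locInt_entrySum hA 0 t).const_mul _
    · refine ae_of_all _ fun u _ => ?_
      simp only [Matrix.mul_apply]
      exact hasSum_sum fun k _ => (hasSum_rightSol hA u i k).mul_right _
  have h2 := (hasSum_nat_add_iff (f := fun n => peano A n t i j) 1).1 h1
  rw [(hasSum_rightSol hA t i j).unique h2]
  simp [peano, add_comm]

theorem hasAEDeriv_rightSol (hA : ∀ i j, LocInt fun u => A u i j) (i j : S) :
    HasAEDeriv (fun t => rightSol A t i j) fun u => (rightSol A u * A u) i j := by
  simp_rw [rightSol_eq_integral hA _ i j]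
  refine HasAEDeriv.of_integral ?_ _
  simp only [Matrix.mul_apply]
  exact LocInt.sum fun k _ => LocInt.continuous_mul (continuous_rightSol hA i k) (hA k j)

theorem hasAEDeriv_leftSol (hA : ∀ i j, LocInt fun u => A u i j) (i j : S) :
    HasAEDeriv (fun t => leftSol A t i j) fun u => -(A u * leftSol A u) i j := by
  refine (hasAEDeriv_rightSol (locInt_neg_transpose hA) j i).congr_deriv fun u => ?_
  simp [leftSol, Matrix.mul_apply, mul_comm]

theorem rightSol_zero (hA : ∀ i j, LocInt fun u => A u i j) : rightSol A 0 = 1 := by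
  ext i j
  simp [rightSol_eq_integral hA 0 i j]

theorem leftSol_zero (hA : ∀ i j, LocInt fun u => A u i j) : leftSol A 0 = 1 := by
  rw [leftSol, rightSol_zero (locInt_neg_transpose hA), Matrix.transpose_one]

/-- The product `Y Z` has derivative `Y A Z - Y A Z = 0` almost everywhere. -/
theorem rightSol_mul_leftSol (hA : ∀ i j, LocInt fun u => A u i j) (t : ℝ) :
    rightSol A t * leftSol A t = 1 := by
  have h0 : rightSol A 0 * leftSol A 0 = 1 := by
    rw [rightSol_zero hA, leftSol_zero hA, one_mul]
  rw [← h0]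
  ext i j
  have h : HasAEDeriv (fun t => (rightSol A t * leftSol A t) i j) fun u =>
      ∑ k, ((rightSol A u * A u) i k * leftSol A u k j
        + rightSol A u i k * -(A u * leftSol A u) k j) := by
    simp only [Matrix.mul_apply (M := rightSol A _) (N := leftSol A _)]
    exact HasAEDeriv.sum fun k _ => (hasAEDeriv_rightSol hA i k).mul (hasAEDeriv_leftSol hA k j)
  refine h.eq_of_deriv_zero (fun u => ?_) t 0
  rw [Finset.sum_add_distrib]
  simp only [mul_neg, Finset.sum_neg_distrib]
  rw [← Matrix.mul_apply, ← Matrix.mul_apply, Matrix.mul_assoc, add_neg_cancel]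

theorem leftSol_mul_rightSol (hA : ∀ i j, LocInt fun u => A u i j) (t : ℝ) :
    leftSol A t * rightSol A t = 1 :=
  mul_eq_one_comm.1 (rightSol_mul_leftSol hA t)

end Evolution

/-! ### Existence of product integrals -/

section Evolution

variable {S : Type*} [Fintype S] {A : ℝ → Matrix S S ℝ}

theorem entrySum_increment_le (hA : ∀ i j, LocInt fun u => A u i j) {a b : ℝ} (hab : a ≤ b) :
    entrySum (increment A a b) ≤ ∫ u in a..b, entrySum (A u) := by
  unfold entrySum
  rw [intervalIntegral.integral_finsetSum
    fun i _ => LocInt.sum (fun j _ => fun a b => (hA i j a b).abs) a b]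
  refine Finset.sum_le_sum fun i _ => ?_
  rw [intervalIntegral.integral_finsetSum fun j _ => (hA i j a b).abs]
  exact Finset.sum_le_sum fun j _ => intervalIntegral.abs_integral_le_integral_abs hab

variable [DecidableEq S]

/-- The two-parameter evolution family `Z(s) Y(t)` of the linear equation `Y' = Y A`. -/
noncomputable def evol (A : ℝ → Matrix S S ℝ) (s t : ℝ) : Matrix S S ℝ :=
  leftSol A s * rightSol A t

theorem evol_self (hA : ∀ i j, LocInt fun u => A u i j) (s : ℝ) : evol A s s = 1 :=
  leftSol_mul_rightSol hA s

theorem evol_mul_evol (hA : ∀ i j, LocInt fun u => A u i j) (s u t : ℝ) :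
    evol A s u * evol A u t = evol A s t := by
  simp only [evol]
  rw [Matrix.mul_assoc, ← Matrix.mul_assoc (rightSol A u), rightSol_mul_leftSol hA, Matrix.one_mul]

theorem continuous_leftSol (hA : ∀ i j, LocInt fun u => A u i j) (i j : S) :
    Continuous fun t => leftSol A t i j :=
  (hasAEDeriv_leftSol hA i j).continuous

theorem hasAEDeriv_evol_right (hA : ∀ i j, LocInt fun u => A u i j) (s : ℝ) (i j : S) :
    HasAEDeriv (fun t => evol A s t i j) fun u => (evol A s u * A u) i j := by
  simp only [evol, Matrix.mul_assoc]
  simp only [Matrix.mul_apply (M := leftSol A s)]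
  refine HasAEDeriv.sum fun k _ => ?_
  refine ((hasAEDeriv_rightSol hA k j).mul_const (leftSol A s i k)).congr_deriv
    (fun u => mul_comm _ _) |> fun h => ?_
  simpa only [mul_comm] using h

theorem hasAEDeriv_evol_left (hA : ∀ i j, LocInt fun u => A u i j) (t : ℝ) (i j : S) :
    HasAEDeriv (fun s => evol A s t i j) fun u => -(A u * evol A u t) i j := by
  simp only [evol, ← Matrix.mul_assoc]
  simp only [Matrix.mul_apply (N := rightSol A t), ← Finset.sum_neg_distrib, ← neg_mul]
  exact HasAEDeriv.sum fun k _ => (hasAEDeriv_leftSol hA i k).mul_const _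

theorem continuous_evol (hA : ∀ i j, LocInt fun u => A u i j) (i j : S) :
    Continuous fun p : ℝ × ℝ => evol A p.1 p.2 i j := by
  simp only [evol, Matrix.mul_apply]
  exact continuous_finsetSum _ fun k _ =>
    ((continuous_leftSol hA i k).comp continuous_fst).mul
      ((continuous_rightSol hA k j).comp continuous_snd)

/-- On a bounded interval the evolution family is bounded, and it differs from `1 + ∫_a^b A` by a
quantity quadratic in the mass of `[a, b]`. -/
theorem abs_evol_sub_one_le (hA : ∀ i j, LocInt fun u => A u i j) (s t : ℝ) :
    ∃ C, 0 ≤ C ∧ ∀ a b, s ≤ a → a ≤ b → b ≤ t → ∀ i j, |evol A a b i j| ≤ C ∧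
      |(evol A a b - 1 - increment A a b) i j| ≤ C * (∫ u in a..b, entrySum (A u)) ^ 2 := by
  obtain ⟨C, hC⟩ : ∃ C, ∀ p ∈ Icc s t ×ˢ Icc s t, ∀ i j, |evol A p.1 p.2 i j| ≤ C := by
    have hK : IsCompact (Icc s t ×ˢ Icc s t) := isCompact_Icc.prod isCompact_Icc
    have hc : Continuous fun p : ℝ × ℝ => entrySum (evol A p.1 p.2) := by
      unfold entrySum
      exact continuous_finsetSum _ fun i _ => continuous_finsetSum _ fun j _ =>
        (continuous_evol hA i j).abs
    obtain ⟨C, hC⟩ := hK.bddAbove_image hc.continuousOn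
    exact ⟨C, fun p hp i j => (abs_le_entrySum _ i j).trans (hC (mem_image_of_mem _ hp))⟩
  have hint (a b : ℝ) (i j : S) : (evol A a b - 1) i j = ∫ u in a..b, (evol A a u * A u) i j := by
    rw [(hasAEDeriv_evol_right hA a i j).integral_eq, evol_self hA, Matrix.sub_apply]
  have hent := locInt_entrySum hA
  have h1 (a b : ℝ) (ha : s ≤ a) (hab : a ≤ b) (hb : b ≤ t) (i j : S) :
      |(evol A a b - 1) i j| ≤ C * ∫ u in a..b, entrySum (A u) := by
    rw [hint, ← intervalIntegral.integral_const_mul]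
    refine intervalIntegral.norm_integral_le_of_norm_le (E := ℝ) hab (ae_of_all _ fun u hu => ?_)
      ((hent a b).const_mul C)
    exact abs_mul_apply_le (fun i j => hC (a, u)
      ⟨⟨ha, hab.trans hb⟩, ⟨ha.trans hu.1.le, hu.2.trans hb⟩⟩ i j) _ _ _
  refine ⟨|C|, abs_nonneg C, fun a b ha hab hb i j => ⟨(hC (a, b)
    ⟨⟨ha, hab.trans hb⟩, ⟨ha.trans hab, hb⟩⟩ i j).trans (le_abs_self C), ?_⟩⟩
  have hmass : ∀ u ∈ Ioc a b, ∫ v in a..u, entrySum (A v) ≤ ∫ v in a..b, entrySum (A v) := by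
    intro u hu
    rw [← intervalIntegral.integral_add_adjacent_intervals (hent a u) (hent u b)]
    have := intervalIntegral.integral_nonneg (μ := volume) hu.2
      fun v _ => entrySum_nonneg (A v)
    linarith
  have hmass0 : 0 ≤ ∫ v in a..b, entrySum (A v) :=
    intervalIntegral.integral_nonneg hab fun v _ => entrySum_nonneg (A v)
  have hsplit : (evol A a b - 1 - increment A a b) i j
      = ∫ u in a..b, ((evol A a u - 1) * A u) i j := by
    rw [Matrix.sub_apply, hint, increment, Matrix.of_apply,
      ← intervalIntegral.integral_sub ((hasAEDeriv_evol_right hA a i j).locInt a b) (hA i j a b)]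
    simp [Matrix.sub_mul]
  rw [hsplit, pow_two, ← mul_assoc, ← intervalIntegral.integral_const_mul]
  refine intervalIntegral.norm_integral_le_of_norm_le (E := ℝ) hab (ae_of_all _ fun u hu => ?_)
      ((hent a b).const_mul _)
  refine abs_mul_apply_le (fun i j => (h1 a u ha hu.1.le (hu.2.trans hb) i j).trans ?_) _ _ _
  refine (mul_le_mul_of_nonneg_right (le_abs_self C) ?_).trans
    (mul_le_mul_of_nonneg_left (hmass u hu) (abs_nonneg C))
  exact intervalIntegral.integral_nonneg hu.1.le fun v _ => entrySum_nonneg (A v)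

theorem partitionProd_succ (A : ℝ → Matrix S S ℝ) (n : ℕ) (u : ℕ → ℝ) :
    partitionProd A (n + 1) u = partitionProd A n u * (1 + increment A (u n) (u (n + 1))) := by
  simp [partitionProd, List.range_succ]

/-- The error of the ordered products is at most the sum of the squared masses of the cells of the
partition, up to a constant: a discrete Gronwall inequality. -/
theorem abs_partitionProd_sub_evol_le (hA : ∀ i j, LocInt fun u => A u i j) {s t C : ℝ}
    (hC0 : 0 ≤ C)
    (hC : ∀ a b, s ≤ a → a ≤ b → b ≤ t → ∀ i j, |evol A a b i j| ≤ C ∧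
      |(evol A a b - 1 - increment A a b) i j| ≤ C * (∫ u in a..b, entrySum (A u)) ^ 2)
    {u : ℕ → ℝ} (hu : Monotone u) (hu0 : u 0 = s) (n : ℕ) (hun : u n ≤ t) (i j : S) :
    |(partitionProd A n u - evol A s (u n)) i j| ≤ Real.exp (∫ v in s..u n, entrySum (A v)) *
      ∑ k ∈ Finset.range n, C * (Fintype.card S ^ 2 * C) *
        (∫ v in u k..u (k + 1), entrySum (A v)) ^ 2 := by
  have hent := locInt_entrySum hA
  induction n generalizing i j with
  | zero => simp [partitionProd, hu0, evol_self hA]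
  | succ n ih =>
    have hn : u n ≤ u (n + 1) := hu (Nat.le_succ n)
    have hs : s ≤ u n := hu0 ▸ hu (Nat.zero_le n)
    have ih := ih (hn.trans hun)
    set I := increment A (u n) (u (n + 1))
    set a := ∫ v in u n..u (n + 1), entrySum (A v)
    have ha0 : 0 ≤ a := intervalIntegral.integral_nonneg hn fun v _ => entrySum_nonneg (A v)
    have hm0 : 0 ≤ ∫ v in s..u n, entrySum (A v) :=
      intervalIntegral.integral_nonneg hs fun v _ => entrySum_nonneg (A v)
    set q := ∑ k ∈ Finset.range n, C * (Fintype.card S ^ 2 * C) *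
        (∫ v in u k..u (k + 1), entrySum (A v)) ^ 2
    have hq : 0 ≤ q := Finset.sum_nonneg fun k _ => by positivity
    have hdec : partitionProd A (n + 1) u - evol A s (u (n + 1)) =
        (partitionProd A n u - evol A s (u n)) + (partitionProd A n u - evol A s (u n)) * I
          - evol A s (u n) * (evol A (u n) (u (n + 1)) - 1 - I) := by
      rw [partitionProd_succ, ← evol_mul_evol hA s (u n) (u (n + 1))]
      noncomm_ring
    have e2 := abs_mul_apply_le ih I i j
    have e3 := abs_mul_apply_le (fun i j => (hC s (u n) le_rfl hs (hn.trans hun) i j).1)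
      (evol A (u n) (u (n + 1)) - 1 - I) i j
    have e4 : entrySum (evol A (u n) (u (n + 1)) - 1 - I) ≤ Fintype.card S ^ 2 * C * a ^ 2 := by
      unfold entrySum
      refine (Finset.sum_le_sum fun i _ => Finset.sum_le_sum fun j _ =>
        (hC (u n) (u (n + 1)) hs hn hun i j).2).trans (le_of_eq ?_)
      simp
      ring
    have e5 : entrySum I ≤ a := entrySum_increment_le hA hn
    rw [hdec, Finset.sum_range_succ, Matrix.sub_apply, Matrix.add_apply,
      ← intervalIntegral.integral_add_adjacent_intervals (hent s (u n)) (hent (u n) (u (n + 1))),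
      Real.exp_add]
    have e1 := ih i j
    set E := Real.exp (∫ v in s..u n, entrySum (A v)) with hE
    have hE1 : 1 ≤ E := Real.one_le_exp hm0
    have hEa : 1 + a ≤ Real.exp a := by linarith [Real.add_one_le_exp a]
    set c := C * (Fintype.card S ^ 2 * C)
    have hc : 0 ≤ c := by positivity
    calc |(partitionProd A n u - evol A s (u n)) i j
          + ((partitionProd A n u - evol A s (u n)) * I) i j
          - (evol A s (u n) * (evol A (u n) (u (n + 1)) - 1 - I)) i j|
        ≤ E * q + E * q * a + c * a ^ 2 := by
          refine (abs_sub _ _).trans (add_le_add ((abs_add_le _ _).trans (add_le_add e1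
            (e2.trans (mul_le_mul_of_nonneg_left e5 (by positivity))))) (e3.trans ?_))
          refine (mul_le_mul_of_nonneg_left e4 hC0).trans (le_of_eq ?_)
          ring
      _ = E * (1 + a) * q + 1 * 1 * (c * a ^ 2) := by ring
      _ ≤ E * Real.exp a * q + E * Real.exp a * (c * a ^ 2) := by
          have : 1 ≤ Real.exp a := by linarith
          gcongr
      _ = E * Real.exp a * (q + c * a ^ 2) := by ring

theorem hasProdIntegral_evol (hA : ∀ i j, LocInt fun u => A u i j) (s t : ℝ) :
    HasProdIntegral A s t (evol A s t) := by
  intro ε hε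
  obtain ⟨C, hC0, hC⟩ := abs_evol_sub_one_le hA s t
  have hent := locInt_entrySum hA
  set m := ∫ v in s..t, entrySum (A v)
  set K := Real.exp m * (C * (Fintype.card S ^ 2 * C)) * m with hK
  -- cells of mass less than `η` suffice
  set η := ε / (|K| + 1)
  have hη : 0 < η := by positivity
  have huc : UniformContinuousOn (fun b => ∫ v in (0 : ℝ)..b, entrySum (A v)) (Icc s t) :=
    isCompact_Icc.uniformContinuousOn_of_continuous
      (hasAEDeriv_mass hA).continuous.continuousOn
  obtain ⟨δ, hδ, H⟩ := Metric.uniformContinuousOn_iff.1 huc η hη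
  refine ⟨δ, hδ, fun n u hu hu0 hun hmesh i j => ?_⟩
  have hbound := abs_partitionProd_sub_evol_le hA hC0 hC hu hu0 n hun.le i j
  rw [hun, Matrix.sub_apply] at hbound
  refine hbound.trans_lt ?_
  have hmem : ∀ k ≤ n, u k ∈ Icc s t := fun k hk =>
    ⟨hu0 ▸ hu (Nat.zero_le k), hun ▸ hu hk⟩
  have hcell : ∀ k < n, (∫ v in u k..u (k + 1), entrySum (A v)) ≤ η := by
    intro k hk
    have := H (u (k + 1)) (hmem _ hk) (u k) (hmem _ hk.le) (by
      rw [Real.dist_eq, abs_of_nonneg (sub_nonneg.2 (hu (Nat.le_succ k)))]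
      exact hmesh k hk)
    rw [Real.dist_eq, intervalIntegral.integral_interval_sub_left (hent _ _) (hent _ _)] at this
    exact (le_abs_self _).trans this.le
  have hsum : ∑ k ∈ Finset.range n, (∫ v in u k..u (k + 1), entrySum (A v)) = m := by
    rw [intervalIntegral.sum_integral_adjacent_intervals fun k _ => hent _ _, hu0, hun]
  have hm : 0 ≤ m := hsum ▸ Finset.sum_nonneg fun k _ =>
    intervalIntegral.integral_nonneg (hu (Nat.le_succ k)) fun v _ => entrySum_nonneg (A v)
  have hK0 : 0 ≤ K := by positivity
  calc Real.exp m * ∑ k ∈ Finset.range n, C * (Fintype.card S ^ 2 * C) *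
        (∫ v in u k..u (k + 1), entrySum (A v)) ^ 2
      ≤ Real.exp m * ∑ k ∈ Finset.range n, C * (Fintype.card S ^ 2 * C) *
        (η * ∫ v in u k..u (k + 1), entrySum (A v)) := by
        refine mul_le_mul_of_nonneg_left (Finset.sum_le_sum fun k hk => ?_) (Real.exp_pos _).le
        refine mul_le_mul_of_nonneg_left ?_ (by positivity)
        rw [pow_two]
        exact mul_le_mul_of_nonneg_right (hcell k (Finset.mem_range.1 hk))
          (intervalIntegral.integral_nonneg (hu (Nat.le_succ k)) fun v _ => entrySum_nonneg (A v))
    _ = K * η := by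
        simp only [← mul_assoc]
        rw [← Finset.mul_sum, hsum]
        ring
    _ < ε := by
        simp only [η]
        rw [abs_of_nonneg hK0, mul_div_assoc', div_lt_iff₀ (by positivity)]
        nlinarith

/-- The value chosen by `prodIntegral` is the product integral whenever there is one. -/
theorem HasProdIntegral.prodIntegral_eq {s t : ℝ} {M : Matrix S S ℝ} (hst : s ≤ t)
    (h : HasProdIntegral A s t M) : prodIntegral A s t = M := by
  have hex : ∃ M, HasProdIntegral A s t M := ⟨M, h⟩
  rw [prodIntegral, dif_pos hex]
  exact hex.choose_spec.unique hst h

/-- Intervals have partitions of arbitrarily small mesh. -/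
theorem exists_partition {s t δ : ℝ} (hst : s ≤ t) (hδ : 0 < δ) :
    ∃ (n : ℕ) (u : ℕ → ℝ), Monotone u ∧ u 0 = s ∧ u n = t ∧ ∀ k < n, u (k + 1) - u k < δ := by
  obtain ⟨n, hn⟩ := exists_nat_gt ((t - s) / (δ / 2))
  rw [div_lt_iff₀ (by positivity)] at hn
  refine ⟨n, fun k => min (s + k * (δ / 2)) t, fun a b hab => ?_, by simp [hst], ?_, fun k _ => ?_⟩
  · have : (a : ℝ) ≤ b := by exact_mod_cast hab
    exact min_le_min (by nlinarith) le_rfl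
  · exact min_eq_right (by linarith)
  · have h1 : min (s + (k + 1 : ℕ) * (δ / 2)) t ≤ min (s + k * (δ / 2)) t + δ / 2 := by
      rw [← min_add_add_right]
      refine min_le_min ?_ (by linarith)
      push_cast
      linarith
    linarith

/-- A property of matrices that passes to entrywise limits and holds for all ordered products of
sufficiently small mesh holds for the product integral. -/
theorem HasProdIntegral.of_isClosed {s t : ℝ} {M : Matrix S S ℝ} (hst : s ≤ t)
    (h : HasProdIntegral A s t M) {p : Matrix S S ℝ → Prop} (hp : IsClosed {N | p N}) {δ : ℝ}
    (hδ : 0 < δ) (H : ∀ (n : ℕ) (u : ℕ → ℝ), Monotone u → u 0 = s → u n = t →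
      (∀ k < n, u (k + 1) - u k < δ) → p (partitionProd A n u)) : p M := by
  have hex : ∀ m : ℕ, ∃ N, p N ∧ ∀ i j, |N i j - M i j| < 1 / ((m : ℝ) + 1) := by
    intro m
    obtain ⟨δ', hδ', H'⟩ := h _ (Nat.one_div_pos_of_nat (α := ℝ) (n := m))
    obtain ⟨n, u, hu, hu0, hun, hmesh⟩ := exists_partition hst (lt_min hδ hδ')
    exact ⟨_, H n u hu hu0 hun fun k hk => (hmesh k hk).trans_le (min_le_left _ _),
      H' n u hu hu0 hun fun k hk => (hmesh k hk).trans_le (min_le_right _ _)⟩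
  choose N hN hNM using hex
  refine hp.mem_of_tendsto (f := N) (b := atTop) ?_ (Eventually.of_forall hN)
  refine tendsto_pi_nhds.2 fun i => tendsto_pi_nhds.2 fun j => ?_
  rw [tendsto_iff_dist_tendsto_zero]
  exact squeeze_zero (fun _ => dist_nonneg) (fun m => (hNM m i j).le)
    tendsto_one_div_add_atTop_nhds_zero_nat

theorem partitionProd_congr {B : ℝ → Matrix S S ℝ} {s t : ℝ} (hAB : ∀ v ∈ Icc s t, A v = B v)
    {n : ℕ} {u : ℕ → ℝ} (hu : Monotone u) (hu0 : u 0 = s) (hun : u n = t) :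
    partitionProd A n u = partitionProd B n u := by
  unfold partitionProd
  congr 1
  refine List.map_congr_left fun k hk => ?_
  congr 1
  ext i j
  simp only [increment, Matrix.of_apply]
  refine intervalIntegral.integral_congr fun v hv => ?_
  rw [uIcc_of_le (hu (Nat.le_succ k))] at hv
  rw [hAB v ⟨?_, ?_⟩]
  · exact (hu0 ▸ hu (Nat.zero_le k)).trans hv.1
  · exact hv.2.trans (hun ▸ hu (List.mem_range.1 hk))

theorem HasProdIntegral.congr {B : ℝ → Matrix S S ℝ} {s t : ℝ} {M : Matrix S S ℝ}
    (h : HasProdIntegral B s t M) (hAB : ∀ v ∈ Icc s t, A v = B v) : HasProdIntegral A s t M := by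
  intro ε hε
  obtain ⟨δ, hδ, H⟩ := h ε hε
  refine ⟨δ, hδ, fun n u hu hu0 hun hmesh => ?_⟩
  rw [partitionProd_congr hAB hu hu0 hun]
  exact H n u hu hu0 hun hmesh

end Evolution

/-! ### Doob transforms of the evolution family of a sub-intensity matrix function -/

section Doob

variable {S : Type*} [Fintype S] [DecidableEq S] {B : ℝ → Matrix S S ℝ}

theorem partitionProd_nonneg {n : ℕ} {u : ℕ → ℝ}
    (h : ∀ k < n, ∀ i j, 0 ≤ (1 + increment B (u k) (u (k + 1))) i j) (i j : S) :
    0 ≤ partitionProd B n u i j := by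
  induction n generalizing i j with
  | zero =>
    simp only [partitionProd, List.range_zero, List.map_nil, List.prod_nil, Matrix.one_apply]
    split_ifs <;> simp
  | succ n ih =>
    rw [partitionProd_succ, Matrix.mul_apply]
    exact Finset.sum_nonneg fun k _ => mul_nonneg
      (ih (fun k hk => h k (hk.trans (Nat.lt_succ_self n))) i k) (h n (Nat.lt_succ_self n) k j)

/-- The ordered products over fine partitions have nonnegative factors. -/
theorem evol_nonneg (hB : ∀ i j, LocInt fun u => B u i j)
    (hoff : ∀ u i j, i ≠ j → 0 ≤ B u i j) {s t : ℝ} (hst : s ≤ t) (i j : S) :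
    0 ≤ evol B s t i j := by
  have hent := locInt_entrySum hB
  have huc : UniformContinuousOn (fun b => ∫ v in (0 : ℝ)..b, entrySum (B v)) (Icc s t) :=
    isCompact_Icc.uniformContinuousOn_of_continuous
      (hasAEDeriv_mass hB).continuous.continuousOn
  obtain ⟨δ, hδ, H⟩ := Metric.uniformContinuousOn_iff.1 huc 1 one_pos
  refine (hasProdIntegral_evol hB s t).of_isClosed hst
    (p := fun N => ∀ i j, 0 ≤ N i j) ?_ hδ ?_ i j
  · simp only [Set.ofPred_forall]
    exact isClosed_iInter fun i => isClosed_iInter fun j =>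
      isClosed_le continuous_const (continuous_apply_apply i j)
  intro n u hu hu0 hun hmesh
  have hmem : ∀ k ≤ n, u k ∈ Icc s t := fun k hk =>
    ⟨hu0 ▸ hu (Nat.zero_le k), hun ▸ hu hk⟩
  refine partitionProd_nonneg fun k hk i j => ?_
  have hle := hu (Nat.le_succ k)
  rw [Matrix.add_apply]
  by_cases hij : i = j
  · subst hij
    -- a cell of mass less than `1` leaves the diagonal nonnegative
    have := H (u (k + 1)) (hmem _ hk) (u k) (hmem _ hk.le) (by
      rw [Real.dist_eq, abs_of_nonneg (sub_nonneg.2 hle)]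
      exact hmesh k hk)
    rw [Real.dist_eq, intervalIntegral.integral_interval_sub_left (hent _ _) (hent _ _)] at this
    have h1 := (abs_le_entrySum _ i i).trans (entrySum_increment_le hB hle)
    have h2 := neg_abs_le (increment B (u k) (u (k + 1)) i i)
    rw [Matrix.one_apply_eq]
    linarith [le_abs_self (∫ v in u k..u (k + 1), entrySum (B v))]
  · rw [Matrix.one_apply_ne hij, zero_add]
    exact intervalIntegral.integral_nonneg hle fun v _ => hoff v i j hij

/-- The backward evolution of a vector `v` given at time `x`: the solution `d` of `d' = -B d` with
`d x = v`. -/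
noncomputable def backward (B : ℝ → Matrix S S ℝ) (x : ℝ) (v : S → ℝ) (u : ℝ) : S → ℝ :=
  evol B u x *ᵥ v

variable {x : ℝ} {v : S → ℝ}

theorem backward_nonneg (hB : ∀ i j, LocInt fun u => B u i j)
    (hoff : ∀ u i j, i ≠ j → 0 ≤ B u i j) (hv : ∀ i, 0 ≤ v i) {u : ℝ} (hu : u ≤ x) (i : S) :
    0 ≤ backward B x v u i :=
  Finset.sum_nonneg fun j _ => mul_nonneg (evol_nonneg hB hoff hu i j) (hv j)

theorem evol_mulVec_backward (hB : ∀ i j, LocInt fun u => B u i j) (s u : ℝ) :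
    evol B s u *ᵥ backward B x v u = backward B x v s := by
  rw [backward, Matrix.mulVec_mulVec, evol_mul_evol hB, backward]

theorem hasAEDeriv_backward (hB : ∀ i j, LocInt fun u => B u i j) (i : S) :
    HasAEDeriv (fun u => backward B x v u i) fun u => -(B u *ᵥ backward B x v u) i := by
  have : HasAEDeriv (fun u => backward B x v u i)
      fun u => ∑ j, -(B u * evol B u x) i j * v j := by
    simp only [backward, Matrix.mulVec, dotProduct]
    exact HasAEDeriv.sum fun j _ => (hasAEDeriv_evol_left hB x i j).mul_const _
  refine this.congr_deriv fun u => ?_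
  rw [backward, Matrix.mulVec_mulVec]
  simp [Matrix.mulVec, dotProduct]

/-- A nonnegative backward solution has a minimum wherever it vanishes, hence its derivative
vanishes there: at almost every such time, no positive rate leads to a state of positive value. -/
theorem ae_rate_mul_backward_eq_zero (hB : ∀ i j, LocInt fun u => B u i j)
    (hoff : ∀ u i j, i ≠ j → 0 ≤ B u i j) (hv : ∀ i, 0 ≤ v i) :
    ∀ᵐ u, u < x → ∀ k, backward B x v u k = 0 → ∀ l, l ≠ k → B u k l * backward B x v u l = 0 := by
  have hd : ∀ᵐ u, ∀ k, HasDerivAt (fun u => backward B x v u k)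
      (-(B u *ᵥ backward B x v u) k) u := ae_all_iff.2 fun k => (hasAEDeriv_backward hB k).deriv
  filter_upwards [hd] with u hu hux k hk l hl
  have hmin : IsLocalMin (fun u => backward B x v u k) u := by
    filter_upwards [Iio_mem_nhds hux] with w hw
    rw [hk]
    exact backward_nonneg hB hoff hv (le_of_lt hw) k
  have h0 := hmin.hasDerivAt_eq_zero (hu k)
  rw [neg_eq_zero, Matrix.mulVec, dotProduct] at h0
  refine (Finset.sum_eq_zero_iff_of_nonneg fun m _ => ?_).1 h0 l (Finset.mem_univ l)
  by_cases hm : m = k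
  · rw [hm, hk, mul_zero]
  · exact mul_nonneg (hoff u k m (Ne.symm hm)) (backward_nonneg hB hoff hv hux.le m)

/-- The transition matrices of the Doob transform by the backward solution `d`; rows `i` with
`d t i = 0` are zero. -/
noncomputable def doob (B : ℝ → Matrix S S ℝ) (d : ℝ → S → ℝ) (t s : ℝ) : Matrix S S ℝ :=
  Matrix.of fun i j => evol B t s i j * d s j / d t i

/-- The intensity matrices of the Doob transform by `d`. -/
noncomputable def doobRate (B : ℝ → Matrix S S ℝ) (d : ℝ → S → ℝ) (t : ℝ) : Matrix S S ℝ :=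
  Matrix.of fun i j =>
    if i = j then -∑ k ∈ Finset.univ.erase i, B t i k * (d t k / d t i)
    else B t i j * (d t j / d t i)

theorem doob_row_sum (hB : ∀ i j, LocInt fun u => B u i j) {s t : ℝ} {i : S}
    (hi : 0 < backward B x v s i) : ∑ j, doob B (backward B x v) s t i j = 1 := by
  simp only [doob, Matrix.of_apply]
  rw [← Finset.sum_div, div_eq_one_iff_eq hi.ne', ← evol_mulVec_backward hB s t]
  rfl

theorem doob_chapman_kolmogorov (hB : ∀ i j, LocInt fun u => B u i j)
    (hoff : ∀ u i j, i ≠ j → 0 ≤ B u i j) (hv : ∀ i, 0 ≤ v i) {s u t : ℝ} (hut : u ≤ t)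
    (htx : t ≤ x) (i j : S) :
    doob B (backward B x v) s t i j =
      ∑ k, doob B (backward B x v) s u i k * doob B (backward B x v) u t k j := by
  set d := backward B x v with hd
  simp only [doob, Matrix.of_apply]
  rw [← evol_mul_evol hB s u t, Matrix.mul_apply, Finset.sum_mul, Finset.sum_div]
  refine Finset.sum_congr rfl fun k _ => ?_
  by_cases hk : d u k = 0
  · -- the vanishing of `d u k` forces every term of `evol B u t *ᵥ d t` in row `k` to vanish
    have h0 := congrFun (evol_mulVec_backward (x := x) (v := v) hB u t) k
    rw [← hd, hk, Matrix.mulVec, dotProduct] at h0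
    have := (Finset.sum_eq_zero_iff_of_nonneg fun m _ => mul_nonneg (evol_nonneg hB hoff hut k m)
      (backward_nonneg hB hoff hv htx m)).1 h0 j (Finset.mem_univ j)
    rw [hk, mul_assoc, this]
    simp
  · field_simp

/-- The terms of the forward equation of the Doob transform, with the denominators at the
intermediate time cancelled. -/
theorem ae_doob_mul_doobRate (hB : ∀ i j, LocInt fun u => B u i j)
    (hoff : ∀ u i j, i ≠ j → 0 ≤ B u i j) (hv : ∀ i, 0 ≤ v i) (s : ℝ) (i k j : S) :
    ∀ᵐ u, u < x → doob B (backward B x v) s u i k * doobRate B (backward B x v) u k j =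
      evol B s u i k * (if k = j then -∑ l ∈ Finset.univ.erase k, B u k l * backward B x v u l
        else B u k j * backward B x v u j) / backward B x v s i := by
  filter_upwards [ae_rate_mul_backward_eq_zero hB hoff hv] with u hu hux
  have hu := hu hux k
  set d := backward B x v
  simp only [doob, doobRate, Matrix.of_apply]
  by_cases hk : d u k = 0
  · have hz := hu hk
    split_ifs with hkj
    · rw [Finset.sum_eq_zero (s := Finset.univ.erase k) (f := fun l => B u k l * d u l)
        fun l hl => hz l (Finset.ne_of_mem_erase hl), hk]
      simp
    · rw [hz j (Ne.symm hkj), hk]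
      simp
  · split_ifs with hkj
    · rw [show ∑ l ∈ Finset.univ.erase k, B u k l * (d u l / d u k) =
        (∑ l ∈ Finset.univ.erase k, B u k l * d u l) / d u k by
          rw [Finset.sum_div]; simp only [mul_div_assoc]]
      field_simp
    · field_simp

theorem locInt_doob_term (hB : ∀ i j, LocInt fun u => B u i j) (s : ℝ) (i k j : S) :
    LocInt fun u => evol B s u i k *
      (if k = j then -∑ l ∈ Finset.univ.erase k, B u k l * backward B x v u l
        else B u k j * backward B x v u j) / backward B x v s i := by
  intro a b
  refine IntervalIntegrable.div_const ?_ _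
  refine LocInt.continuous_mul (hasAEDeriv_evol_right hB s i k).continuous ?_ a b
  split_ifs with hkj
  · intro a b
    exact (LocInt.sum (fun l _ => (hB k l).mul_continuous (hasAEDeriv_backward hB l).continuous)
      a b).neg
  · exact (hB k j).mul_continuous (hasAEDeriv_backward hB j).continuous

theorem doob_intervalIntegrable (hB : ∀ i j, LocInt fun u => B u i j)
    (hoff : ∀ u i j, i ≠ j → 0 ≤ B u i j) (hv : ∀ i, 0 ≤ v i) {s t : ℝ} (hst : s ≤ t) (htx : t < x)
    (i k j : S) :
    IntervalIntegrable (fun u => doob B (backward B x v) s u i k *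
      doobRate B (backward B x v) u k j) volume s t := by
  refine (locInt_doob_term (x := x) (v := v) hB s i k j s t).congr_ae ?_
  filter_upwards [ae_restrict_of_ae (ae_doob_mul_doobRate (x := x) hB hoff hv s i k j),
    ae_restrict_mem measurableSet_uIoc] with u hu hu'
  rw [uIoc_of_le hst] at hu'
  exact (hu (hu'.2.trans_lt htx)).symm

/-- The forward equation of the Doob transform is the product rule for `evol B s u i j * d u j`: the
diagonal entry `B u j j` contributes with opposite signs to the two factors and cancels. -/
theorem doob_forward (hB : ∀ i j, LocInt fun u => B u i j)
    (hoff : ∀ u i j, i ≠ j → 0 ≤ B u i j) (hv : ∀ i, 0 ≤ v i) {s t : ℝ} (hst : s ≤ t) (htx : t < x)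
    {i : S} (hi : 0 < backward B x v s i) (j : S) :
    doob B (backward B x v) s t i j = (1 : Matrix S S ℝ) i j +
      ∫ u in s..t, ∑ k, doob B (backward B x v) s u i k * doobRate B (backward B x v) u k j := by
  set d := backward B x v with hd
  have h1 := (((hasAEDeriv_evol_right hB s i j).mul
    (hasAEDeriv_backward (x := x) (v := v) hB j)).mul_const (d s i)⁻¹)
  have h2 := h1.integral_eq s t
  have h3 : ∫ u in s..t, ∑ k, doob B d s u i k * doobRate B d u k j = ∫ u in s..t,
      ((evol B s u * B u) i j * backward B x v u j +
        evol B s u i j * -(B u *ᵥ backward B x v u) j) * (d s i)⁻¹ := by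
    refine intervalIntegral.integral_congr_ae ?_
    filter_upwards [ae_all_iff.2 fun k => ae_doob_mul_doobRate (x := x) hB hoff hv s i k j]
      with u hu hu'
    rw [uIoc_of_le hst] at hu'
    rw [Finset.sum_congr rfl fun k _ => hu k (hu'.2.trans_lt htx), ← hd, ← Finset.sum_div,
      div_eq_mul_inv]
    congr 1
    have hoffd : ∀ k ∈ Finset.univ.erase j, (evol B s u i k * if k = j then
        -∑ l ∈ Finset.univ.erase k, B u k l * d u l else B u k j * d u j) =
        evol B s u i k * (B u k j * d u j) := fun k hk => by
      rw [if_neg (Finset.ne_of_mem_erase hk)]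
    rw [← Finset.add_sum_erase _ _ (Finset.mem_univ j), if_pos rfl,
      Finset.sum_congr rfl hoffd, Matrix.mul_apply, Matrix.mulVec, dotProduct,
      ← Finset.add_sum_erase (a := j) _ (fun k => B u j k * d u k) (Finset.mem_univ j),
      ← Finset.add_sum_erase (a := j) _ (fun k => evol B s u i k * B u k j) (Finset.mem_univ j),
      add_mul, Finset.sum_mul]
    simp only [mul_assoc]
    ring
  rw [h3, h2, evol_self hB, doob, Matrix.of_apply, ← hd, Matrix.one_apply]
  split_ifs with hij
  · subst hij
    field_simp
    ring
  · ring

/-- If the solutions have right derivatives at `t`, the Doob transform has the expected rates. -/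
theorem doob_hasTransitionRate (hB : ∀ i j, LocInt fun u => B u i j) {t : ℝ}
    (hY : ∀ i j, HasDerivWithinAt (fun u => rightSol B u i j) ((rightSol B t * B t) i j) (Ici t) t)
    (hZ : ∀ i j, HasDerivWithinAt (fun u => leftSol B u i j) (-(B t * leftSol B t) i j) (Ici t) t)
    {i : S} (hi : 0 < backward B x v t i) (j : S) :
    HasTransitionRate (doob B (backward B x v)) t i j (doobRate B (backward B x v) t i j) := by
  set d := backward B x v with hd
  have he : HasDerivWithinAt (fun u => evol B t u i j) (B t i j) (Ici t) t := by
    have h1 : HasDerivWithinAt (fun u => evol B t u i j)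
        (∑ k, leftSol B t i k * (rightSol B t * B t) k j) (Ici t) t := by
      simp only [evol, Matrix.mul_apply (M := leftSol B t)]
      exact HasDerivWithinAt.fun_sum fun k _ => (hY k j).const_mul _
    rwa [← Matrix.mul_apply, ← Matrix.mul_assoc, leftSol_mul_rightSol hB, Matrix.one_mul] at h1
  have hdj : HasDerivWithinAt (fun u => d u j) (-(B t *ᵥ d t) j) (Ici t) t := by
    have h1 : HasDerivWithinAt (fun u => d u j)
        (∑ k, -(B t * leftSol B t) j k * (rightSol B x *ᵥ v) k) (Ici t) t := by
      have hexp : (fun u => d u j) = fun u => ∑ k, leftSol B u j k * (rightSol B x *ᵥ v) k := by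
        ext u
        rw [hd, backward, evol, ← Matrix.mulVec_mulVec]
        rfl
      rw [hexp]
      exact HasDerivWithinAt.fun_sum fun k _ => (hZ j k).mul_const _
    convert h1 using 1
    rw [hd, backward, evol, ← Matrix.mulVec_mulVec, Matrix.mulVec_mulVec]
    simp only [neg_mul, Finset.sum_neg_distrib]
    rfl
  have hF := ((he.mul hdj).mul_const (d t i)⁻¹)
  have hval : (B t i j * d t j + evol B t t i j * -(B t *ᵥ d t) j) * (d t i)⁻¹
      = doobRate B d t i j := by
    rw [evol_self hB, doobRate, Matrix.of_apply, Matrix.one_apply]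
    split_ifs with hij
    · subst hij
      rw [Matrix.mulVec, dotProduct, ← Finset.add_sum_erase _ _ (Finset.mem_univ i),
        show ∑ l ∈ Finset.univ.erase i, B t i l * (d t l / d t i) =
        (∑ l ∈ Finset.univ.erase i, B t i l * d t l) / d t i by
          rw [Finset.sum_div]; simp only [mul_div_assoc]]
      field_simp
      ring
    · field_simp
      ring
  rw [hval, hasDerivWithinAt_iff_tendsto_slope] at hF
  have hshift : Tendsto (fun h : ℝ => t + h) (𝓝[>] 0) (𝓝[Ici t \ {t}] t) := by
    refine tendsto_nhdsWithin_iff.2 ⟨?_, ?_⟩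
    · have : Tendsto (fun h : ℝ => t + h) (𝓝 0) (𝓝 (t + 0)) :=
        (continuous_const.add continuous_id).tendsto 0
      rw [add_zero] at this
      exact this.mono_left nhdsWithin_le_nhds
    · filter_upwards [self_mem_nhdsWithin] with h hh
      rw [mem_Ioi] at hh
      exact ⟨by simp [hh.le], by simp [hh.ne']⟩
  refine (hF.comp hshift).congr fun h => ?_
  simp only [Function.comp, slope, vsub_eq_sub, add_sub_cancel_left, smul_eq_mul, Pi.mul_apply]
  rw [evol_self hB, doob, Matrix.of_apply, Matrix.one_apply]
  split_ifs with hij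
  · subst hij
    field_simp
  · simp
    ring

end Doob

section HalfLine

/-! ### Product integrals of intensity matrices on the half-line -/

/-- The extension by zero to negative times, which turns local integrability on the half-line into
local integrability on the line. -/
noncomputable def extendZero {S : Type*} (A : ℝ → Matrix S S ℝ) (u : ℝ) : Matrix S S ℝ :=
  if 0 ≤ u then A u else 0

theorem extendZero_of_nonneg {S : Type*} (A : ℝ → Matrix S S ℝ) {u : ℝ} (hu : 0 ≤ u) :
    extendZero A u = A u := if_pos hu

theorem locInt_extendZero {S : Type*} {A : ℝ → Matrix S S ℝ}
    (hA : ∀ t, 0 ≤ t → ∀ i j, IntervalIntegrable (fun u => A u i j) volume 0 t) (i j : S) :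
    LocInt fun u => extendZero A u i j := by
  have h0 : ∀ t, IntervalIntegrable (fun u => extendZero A u i j) volume 0 t := by
    intro t
    rcases le_total 0 t with ht | ht
    · refine (hA t ht i j).congr_ae ?_
      filter_upwards [ae_restrict_mem measurableSet_uIoc] with u hu
      rw [uIoc_of_le ht] at hu
      rw [extendZero_of_nonneg A hu.1.le]
    · refine (intervalIntegrable_const (c := (0 : ℝ))).congr_ae ?_
      filter_upwards [ae_restrict_mem measurableSet_uIoc,
        ae_restrict_of_ae (Measure.ae_ne volume (0 : ℝ))] with u hu hu0
      rw [uIoc_of_ge ht] at hu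
      rw [extendZero, if_neg (not_le.2 (lt_of_le_of_ne hu.2 hu0)), Matrix.zero_apply]
  exact fun a b => (h0 a).symm.trans (h0 b)

theorem prodIntegral_eq_evol_extendZero {S : Type*} [Fintype S] [DecidableEq S]
    {A : ℝ → Matrix S S ℝ}
    (hA : ∀ t, 0 ≤ t → ∀ i j, IntervalIntegrable (fun u => A u i j) volume 0 t) {s t : ℝ}
    (hs : 0 ≤ s) (hst : s ≤ t) : prodIntegral A s t = evol (extendZero A) s t :=
  ((hasProdIntegral_evol (locInt_extendZero hA) s t).congr fun _ hv =>
    (extendZero_of_nonneg A (hs.trans hv.1)).symm).prodIntegral_eq hst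

theorem hasProdIntegral_prodIntegral {S : Type*} [Fintype S] [DecidableEq S]
    {A : ℝ → Matrix S S ℝ}
    (hA : ∀ t, 0 ≤ t → ∀ i j, IntervalIntegrable (fun u => A u i j) volume 0 t) {s t : ℝ}
    (hs : 0 ≤ s) (hst : s ≤ t) : HasProdIntegral A s t (prodIntegral A s t) := by
  rw [prodIntegral_eq_evol_extendZero hA hs hst]
  exact (hasProdIntegral_evol (locInt_extendZero hA) s t).congr fun _ hv =>
    (extendZero_of_nonneg A (hs.trans hv.1)).symm

variable {p : ℕ} {T : ℝ → Matrix (Fin p) (Fin p) ℝ}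

theorem IsSubIntensity.exitRate_nonneg (hT : IsSubIntensity T) {x : ℝ} (hx : 0 ≤ x) (i : Fin p) :
    0 ≤ exitRate T x i :=
  neg_nonneg.2 (hT.row_sum_nonpos x hx i)

theorem IsSubIntensity.locInt (hT : IsSubIntensity T) (i j : Fin p) :
    LocInt fun u => extendZero T u i j := locInt_extendZero hT.integrable i j

theorem IsSubIntensity.extendZero_offDiag (hT : IsSubIntensity T) (u : ℝ) (i j : Fin p)
    (hij : i ≠ j) : 0 ≤ extendZero T u i j := by
  unfold extendZero
  split_ifs with hu
  · exact hT.offDiag_nonneg u hu i j hij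
  · simp

theorem IsSubIntensity.fullIntensity_integrable (hT : IsSubIntensity T) (t : ℝ) (ht : 0 ≤ t)
    (i j : Fin p ⊕ Unit) : IntervalIntegrable (fun u => fullIntensity T u i j) volume 0 t := by
  rcases i with i | i
  · rcases j with j | j
    · simpa [fullIntensity] using hT.integrable t ht i j
    · have := (IntervalIntegrable.sum Finset.univ fun j _ => hT.integrable t ht i j).neg
      refine this.congr_ae (ae_of_all _ fun u => ?_)
      simp [fullIntensity, exitRate]
  · rcases j with j | j <;> simp [fullIntensity]

/-- Block structure: the ordered products of the full intensity matrices have those of `T` as their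
upper left block and a vanishing lower left block. -/
theorem partitionProd_fullIntensity (T : ℝ → Matrix (Fin p) (Fin p) ℝ) (n : ℕ) (u : ℕ → ℝ) :
    (∀ i j, partitionProd (fullIntensity T) n u (Sum.inl i) (Sum.inl j) = partitionProd T n u i j) ∧
      ∀ j, partitionProd (fullIntensity T) n u (Sum.inr ()) (Sum.inl j) = 0 := by
  induction n with
  | zero => simp [partitionProd, Matrix.one_apply]
  | succ n ih =>
    simp only [partitionProd_succ, Matrix.mul_apply, Fintype.sum_sum_type, ih.1, ih.2]
    simp [increment, fullIntensity, Matrix.one_apply]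

theorem prodIntegral_fullIntensity_inl_inl (hT : IsSubIntensity T) {s t : ℝ} (hs : 0 ≤ s)
    (hst : s ≤ t) (i j : Fin p) :
    prodIntegral (fullIntensity T) s t (Sum.inl i) (Sum.inl j) = prodIntegral T s t i j := by
  have h := hasProdIntegral_prodIntegral hT.fullIntensity_integrable hs hst
  have h' : HasProdIntegral T s t (Matrix.of fun i j =>
      prodIntegral (fullIntensity T) s t (Sum.inl i) (Sum.inl j)) := by
    intro ε hε
    obtain ⟨δ, hδ, H⟩ := h ε hε
    refine ⟨δ, hδ, fun n u hu hu0 hun hmesh i j => ?_⟩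
    have := H n u hu hu0 hun hmesh (Sum.inl i) (Sum.inl j)
    rwa [(partitionProd_fullIntensity T n u).1] at this
  rw [h'.prodIntegral_eq hst, Matrix.of_apply]

theorem prodIntegral_fullIntensity_inr_inl (hT : IsSubIntensity T) {s t : ℝ} (hs : 0 ≤ s)
    (hst : s ≤ t) (j : Fin p) :
    prodIntegral (fullIntensity T) s t (Sum.inr ()) (Sum.inl j) = 0 := by
  refine (hasProdIntegral_prodIntegral hT.fullIntensity_integrable hs hst).of_isClosed hst
    (p := fun N => N (Sum.inr ()) (Sum.inl j) = 0) ?_ one_pos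
    fun n u _ _ _ _ => (partitionProd_fullIntensity T n u).2 j
  exact isClosed_eq (continuous_id.matrix_elem _ _) continuous_const

/-- The density in `u` of the probability of absorption after time `s`, from the state `i` at time
`s`; for `0 ≤ s ≤ u` it is `absorbDensity T u s i`. As a function of `u` it is locally
integrable on the whole line. -/
noncomputable def absorbRate (T : ℝ → Matrix (Fin p) (Fin p) ℝ) (s : ℝ) (i : Fin p) (u : ℝ) : ℝ :=
  (evol (extendZero T) s u *ᵥ exitRate (extendZero T) u) i

theorem absorbDensity_eq_absorbRate (hT : IsSubIntensity T) {s u : ℝ} (hs : 0 ≤ s) (hsu : s ≤ u)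
    (i : Fin p) : absorbDensity T u s i = absorbRate T s i u := by
  rw [absorbDensity, absorbRate, prodIntegral_eq_evol_extendZero hT.integrable hs hsu]
  have : exitRate T u = exitRate (extendZero T) u := by
    unfold exitRate
    rw [extendZero_of_nonneg T (hs.trans hsu)]
  rw [this]

theorem locInt_absorbRate (hT : IsSubIntensity T) (s : ℝ) (i : Fin p) :
    LocInt (absorbRate T s i) := by
  unfold absorbRate
  simp only [Matrix.mulVec, dotProduct, exitRate]
  refine LocInt.sum fun k _ => LocInt.continuous_mul (hasAEDeriv_evol_right hT.locInt s i k).continuous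
    fun a b => ?_
  exact (LocInt.sum (fun j _ => hT.locInt k j) a b).neg

theorem absorbDensity_eq_backward (hT : IsSubIntensity T) {x t : ℝ} (ht : 0 ≤ t) (htx : t ≤ x) :
    absorbDensity T x t = backward (extendZero T) x (exitRate T x) t := by
  rw [absorbDensity, backward, prodIntegral_eq_evol_extendZero hT.integrable ht htx]

theorem absorbDensity_nonneg (hT : IsSubIntensity T) {x t : ℝ} (ht : 0 ≤ t) (htx : t ≤ x)
    (i : Fin p) : 0 ≤ absorbDensity T x t i := by
  rw [absorbDensity_eq_backward hT ht htx]
  exact backward_nonneg hT.locInt hT.extendZero_offDiag (hT.exitRate_nonneg (ht.trans htx)) htx i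

/-- The probability of absorption between the times `s` and `t`, from the state `i`. -/
theorem prodIntegral_fullIntensity_inl_inr (hT : IsSubIntensity T) {s t : ℝ} (hs : 0 ≤ s)
    (hst : s ≤ t) (i : Fin p) :
    prodIntegral (fullIntensity T) s t (Sum.inl i) (Sum.inr ()) =
      ∫ u in s..t, absorbRate T s i u := by
  have hL := locInt_extendZero hT.fullIntensity_integrable
  have h := (hasAEDeriv_evol_right hL s (Sum.inl i) (Sum.inr ())).integral_eq s t
  rw [evol_self hL, Matrix.one_apply_ne (by simp), sub_zero] at h
  rw [prodIntegral_eq_evol_extendZero hT.fullIntensity_integrable hs hst, ← h]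
  refine intervalIntegral.integral_congr fun u hu => ?_
  rw [uIcc_of_le hst] at hu
  have hu0 : 0 ≤ u := hs.trans hu.1
  rw [← absorbDensity_eq_absorbRate hT hs hu.1, absorbDensity, Matrix.mulVec, dotProduct,
    ← prodIntegral_eq_evol_extendZero hT.fullIntensity_integrable hs hu.1,
    extendZero_of_nonneg _ hu0, Matrix.mul_apply, Fintype.sum_sum_type]
  simp [fullIntensity, prodIntegral_fullIntensity_inl_inl hT hs hu.1]

/-! ### The conditional transition function -/

theorem condTransition_eq_doob (hT : IsSubIntensity T) {x s t : ℝ} (hs : 0 ≤ s) (hst : s ≤ t)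
    (htx : t ≤ x) : condTransition T x s t =
      doob (extendZero T) (backward (extendZero T) x (exitRate T x)) s t := by
  ext i j
  rw [condTransition, doob, Matrix.of_apply, Matrix.of_apply,
    prodIntegral_eq_evol_extendZero hT.integrable hs hst,
    absorbDensity_eq_backward hT hs (hst.trans htx),
    absorbDensity_eq_backward hT (hs.trans hst) htx]

theorem condIntensity_eq_doobRate (hT : IsSubIntensity T) {x t : ℝ} (ht : 0 ≤ t) (htx : t ≤ x) :
    condIntensity T x t =
      doobRate (extendZero T) (backward (extendZero T) x (exitRate T x)) t := by
  ext i j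
  rw [condIntensity, doobRate, Matrix.of_apply, Matrix.of_apply, absorbDensity_eq_backward hT ht htx,
    extendZero_of_nonneg T ht]

theorem isTransitionFunction_condTransition (hT : IsSubIntensity T) {x : ℝ} :
    IsTransitionFunction x (possibleStates T x) (condTransition T x) (condIntensity T x) where
  nonneg s t hs hst htx i _ j := by
    rw [condTransition, Matrix.of_apply]
    refine div_nonneg (mul_nonneg ?_ (absorbDensity_nonneg hT (hs.trans hst) htx.le j))
      (absorbDensity_nonneg hT hs (hst.trans htx.le) i)
    rw [prodIntegral_eq_evol_extendZero hT.integrable hs hst]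
    exact evol_nonneg hT.locInt hT.extendZero_offDiag hst i j
  row_sum s t hs hst htx i hi := by
    rw [possibleStates, mem_ofPred_eq, absorbDensity_eq_backward hT hs (hst.trans htx.le)] at hi
    rw [condTransition_eq_doob hT hs hst htx.le]
    exact doob_row_sum hT.locInt hi
  chapman_kolmogorov s u t hs hsu hut htx i _ j := by
    rw [condTransition_eq_doob hT hs (hsu.trans hut) htx.le,
      condTransition_eq_doob hT hs hsu (hut.trans htx.le),
      condTransition_eq_doob hT (hs.trans hsu) hut htx.le]
    exact doob_chapman_kolmogorov hT.locInt hT.extendZero_offDiag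
      (hT.exitRate_nonneg (hs.trans (hsu.trans (hut.trans htx.le)))) hut htx.le i j
  forward_integrable s t hs hst htx i _ k j := by
    refine (doob_intervalIntegrable hT.locInt hT.extendZero_offDiag
      (hT.exitRate_nonneg (hs.trans (hst.trans htx.le))) hst htx i k j).congr_ae ?_
    filter_upwards [ae_restrict_mem measurableSet_uIoc] with u hu
    rw [uIoc_of_le hst] at hu
    rw [condTransition_eq_doob hT hs hu.1.le (hu.2.trans htx.le),
      condIntensity_eq_doobRate hT (hs.trans hu.1.le) (hu.2.trans htx.le)]
  forward s t hs hst htx i hi j := by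
    rw [possibleStates, mem_ofPred_eq, absorbDensity_eq_backward hT hs (hst.trans htx.le)] at hi
    rw [condTransition_eq_doob hT hs hst htx.le, doob_forward hT.locInt hT.extendZero_offDiag
      (hT.exitRate_nonneg (hs.trans (hst.trans htx.le))) hst htx hi]
    congr 1
    refine intervalIntegral.integral_congr fun u hu => ?_
    rw [uIcc_of_le hst] at hu
    rw [condTransition_eq_doob hT hs hu.1 (hu.2.trans htx.le),
      condIntensity_eq_doobRate hT (hs.trans hu.1) (hu.2.trans htx.le)]

theorem hasTransitionRate_condTransition (hT : IsSubIntensity T) {x t : ℝ} (ht : 0 ≤ t)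
    (htx : t < x)
    (hY : ∀ i j, HasDerivWithinAt (fun u => rightSol (extendZero T) u i j)
      ((rightSol (extendZero T) t * extendZero T t) i j) (Ici t) t)
    (hZ : ∀ i j, HasDerivWithinAt (fun u => leftSol (extendZero T) u i j)
      (-(extendZero T t * leftSol (extendZero T) t) i j) (Ici t) t)
    {i : Fin p} (hi : i ∈ possibleStates T x t) (j : Fin p) :
    HasTransitionRate (condTransition T x) t i j (condIntensity T x t i j) := by
  rw [possibleStates, mem_ofPred_eq, absorbDensity_eq_backward hT ht htx.le] at hi
  rw [condIntensity_eq_doobRate hT ht htx.le]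
  refine (doob_hasTransitionRate hT.locInt hY hZ hi j).congr' ?_
  filter_upwards [Ioo_mem_nhdsGT (sub_pos.2 htx)] with h hh
  rw [condTransition_eq_doob hT ht (by linarith [hh.1]) (by linarith [hh.2])]

theorem ae_hasTransitionRate_condTransition (hT : IsSubIntensity T) (x : ℝ) :
    ∀ᵐ t : ℝ, 0 ≤ t → t < x → ∀ i ∈ possibleStates T x t, ∀ j,
      HasTransitionRate (condTransition T x) t i j (condIntensity T x t i j) := by
  filter_upwards [ae_all_iff.2 fun i => ae_all_iff.2 fun j =>
      (hasAEDeriv_rightSol hT.locInt i j).deriv,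
    ae_all_iff.2 fun i => ae_all_iff.2 fun j => (hasAEDeriv_leftSol hT.locInt i j).deriv]
    with t hY hZ ht htx i hi j
  exact hasTransitionRate_condTransition hT ht htx (fun i j => (hY i j).hasDerivWithinAt)
    (fun i j => (hZ i j).hasDerivWithinAt) hi j

theorem hasTransitionRate_condTransition_of_continuousWithinAt (hT : IsSubIntensity T) {x t : ℝ}
    (ht : 0 ≤ t) (htx : t < x) (hc : ∀ k l, ContinuousWithinAt (fun u => T u k l) (Ici t) t)
    {i : Fin p} (hi : i ∈ possibleStates T x t) (j : Fin p) :
    HasTransitionRate (condTransition T x) t i j (condIntensity T x t i j) := by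
  have hc' : ∀ k l, ContinuousWithinAt (fun u => extendZero T u k l) (Ici t) t := fun k l =>
    (hc k l).congr (fun u hu => by rw [extendZero_of_nonneg T (ht.trans hu)])
      (by rw [extendZero_of_nonneg T ht])
  refine hasTransitionRate_condTransition hT ht htx
    (fun i j => (hasAEDeriv_rightSol hT.locInt i j).hasDerivWithinAt ?_)
    (fun i j => (hasAEDeriv_leftSol hT.locInt i j).hasDerivWithinAt ?_) hi j
  · simp only [Matrix.mul_apply]
    exact tendsto_finsetSum _ fun k _ =>
      (continuous_rightSol hT.locInt i k).continuousWithinAt.mul (hc' k j)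
  · simp only [Matrix.mul_apply, ← Finset.sum_neg_distrib]
    exact tendsto_finsetSum _ fun k _ =>
      ((hc' i k).mul (continuous_leftSol hT.locInt k j).continuousWithinAt).neg

end HalfLine

/-! ### The space of jump paths -/

section JumpPath

variable {E : Type*}

/-- A jump path is constant on some interval `[t, t + 1 / (N + 1))`. -/
theorem JumpPath.exists_right (f : JumpPath E) (t : ℝ≥0) :
    ∃ N : ℕ, ∀ u, t ≤ u → u < t + 1 / ((N : ℝ≥0) + 1) → f.1 u = f.1 t := by
  have h := (f.2 t ENNReal.coe_lt_top).1
  obtain ⟨v, hv, H⟩ := (mem_nhdsGE_iff_exists_Ico_subset' (lt_add_one t)).1 h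
  obtain ⟨N, hN⟩ := exists_nat_one_div_lt (K := ℝ≥0) (tsub_pos_of_lt hv)
  refine ⟨N, fun u hu hu' => H ⟨hu, hu'.trans ?_⟩⟩
  have := add_lt_add_right hN t
  rwa [add_tsub_cancel_of_le (le_of_lt hv)] at this

theorem exists_denseSeq_between {s t : ℝ≥0} (h : s < t) :
    ∃ n, s < TopologicalSpace.denseSeq ℝ≥0 n ∧ TopologicalSpace.denseSeq ℝ≥0 n < t := by
  obtain ⟨_, ⟨n, rfl⟩, hn⟩ :=
    (TopologicalSpace.denseRange_denseSeq ℝ≥0).exists_between h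
  exact ⟨n, hn⟩

open TopologicalSpace (denseSeq)

/-- The value at `u` of a jump path is determined by the values at times `m n` that approach `u`
from the right. -/
theorem JumpPath.eq_iff (f : JumpPath E) {u : ℝ≥0} {m : ℕ → ℝ≥0}
    (hm : ∀ n, u < denseSeq ℝ≥0 n → u ≤ m n ∧ m n ≤ denseSeq ℝ≥0 n) (e : E) :
    f.1 u = e ↔ ∃ N : ℕ, ∀ n, u < denseSeq ℝ≥0 n →
      denseSeq ℝ≥0 n < u + 1 / ((N : ℝ≥0) + 1) → f.1 (m n) = e := by
  obtain ⟨N, hN⟩ := f.exists_right u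
  constructor
  · rintro rfl
    exact ⟨N, fun n h1 h2 => hN _ (hm n h1).1 ((hm n h1).2.trans_lt h2)⟩
  · rintro ⟨N', hN'⟩
    obtain ⟨n, h1, h2⟩ := exists_denseSeq_between (s := u)
      (t := min (u + 1 / ((N : ℝ≥0) + 1)) (u + 1 / ((N' : ℝ≥0) + 1)))
      (lt_min (lt_add_of_pos_right _ (by positivity)) (lt_add_of_pos_right _ (by positivity)))
    rw [← hN _ (hm n h1).1 ((hm n h1).2.trans_lt (h2.trans_le (min_le_left _ _)))]
    exact hN' n h1 (h2.trans_le (min_le_right _ _))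

/-- The values of a path along a dense sequence of times. -/
noncomputable def sample (f : JumpPath E) (n : ℕ) : E := f.1 (denseSeq ℝ≥0 n)

/-- The functions on the dense sequence of times that come from jump paths: on short intervals they
switch at most once, and they are right-continuous. -/
def sampleRange (E : Type*) : Set (ℕ → E) :=
  {g | (∀ M : ℕ, ∃ N : ℕ, ∀ a b c, denseSeq ℝ≥0 a < denseSeq ℝ≥0 b →
      denseSeq ℝ≥0 b < denseSeq ℝ≥0 c → denseSeq ℝ≥0 c ≤ M →
      denseSeq ℝ≥0 c < denseSeq ℝ≥0 a + 1 / ((N : ℝ≥0) + 1) → g a = g b ∨ g b = g c) ∧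
    ∀ a, ∃ N : ℕ, ∀ b, denseSeq ℝ≥0 a ≤ denseSeq ℝ≥0 b →
      denseSeq ℝ≥0 b < denseSeq ℝ≥0 a + 1 / ((N : ℝ≥0) + 1) → g b = g a}

/-- Around each time a jump path is constant on a left and on a right neighbourhood; a Lebesgue
number of this cover of `[0, M]` bounds the distance of any two switches. -/
theorem sample_mem_sampleRange (f : JumpPath E) : sample f ∈ sampleRange E := by
  refine ⟨fun M => ?_, fun a => ?_⟩
  · have hloc : ∀ t : ℝ≥0, ∃ U : Set ℝ≥0, IsOpen U ∧ t ∈ U ∧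
        (∀ u ∈ U, ∀ v ∈ U, u < t → v < t → f.1 u = f.1 v) ∧
        ∀ u ∈ U, ∀ v ∈ U, t ≤ u → t ≤ v → f.1 u = f.1 v := by
      intro t
      obtain ⟨hr, e, hl⟩ := f.2 t ENNReal.coe_lt_top
      rw [eventually_nhdsWithin_iff] at hr hl
      obtain ⟨U, hU, hUo, htU⟩ := eventually_nhds_iff.1 (hr.and hl)
      exact ⟨U, hUo, htU, fun u hu v hv hut hvt => by rw [(hU u hu).2 hut, (hU v hv).2 hvt],
        fun u hu v hv hut hvt => by rw [(hU u hu).1 hut, (hU v hv).1 hvt]⟩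
    choose U hUo htU hUl hUr using hloc
    obtain ⟨δ, hδ, H⟩ := lebesgue_number_lemma_of_metric (isCompact_Icc (a := (0 : ℝ≥0)) (b := M))
      hUo fun t _ => mem_iUnion.2 ⟨t, htU t⟩
    obtain ⟨N, hN⟩ := exists_nat_one_div_lt hδ
    refine ⟨N, fun a b c hab hbc hcM hca => ?_⟩
    obtain ⟨t, ht⟩ := H (denseSeq ℝ≥0 a) ⟨zero_le, ((hab.trans hbc).le.trans hcM)⟩
    have hmem : ∀ u, denseSeq ℝ≥0 a ≤ u → u ≤ denseSeq ℝ≥0 c → u ∈ U t := by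
      intro u hau huc
      refine ht ?_
      rw [Metric.mem_ball, NNReal.dist_eq, abs_of_nonneg (sub_nonneg.2 (NNReal.coe_le_coe.2 hau))]
      have := NNReal.coe_lt_coe.2 (huc.trans_lt hca)
      push_cast at this
      linarith
    have ha := hmem _ le_rfl (hab.trans hbc).le
    have hb := hmem _ hab.le hbc.le
    have hc := hmem _ (hab.trans hbc).le le_rfl
    rcases lt_or_ge (denseSeq ℝ≥0 b) t with hbt | hbt
    · exact Or.inl (hUl t _ ha _ hb (hab.trans hbt) hbt)
    · exact Or.inr (hUr t _ hb _ hc hbt (hbt.trans hbc.le))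
  · obtain ⟨N, hN⟩ := f.exists_right (denseSeq ℝ≥0 a)
    exact ⟨N, fun b h1 h2 => hN _ h1 h2⟩

/-- An element of `sampleRange` is constant immediately to the right of each time. -/
theorem exists_right_limit {g : ℕ → E} (hg : g ∈ sampleRange E) (t : ℝ≥0) :
    ∃ (e : E) (v : ℝ≥0), t < v ∧ ∀ a, t < denseSeq ℝ≥0 a → denseSeq ℝ≥0 a < v → g a = e := by
  obtain ⟨M, hM⟩ := exists_nat_gt (t + 1)
  obtain ⟨N, hN⟩ := hg.1 M
  set r : ℝ≥0 := 1 / ((N : ℝ≥0) + 1) with hr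
  have hr0 : 0 < r := by positivity
  have hr1 : r ≤ 1 := by
    rw [hr, div_le_one (by positivity)]
    exact le_add_of_nonneg_left (by positivity)
  by_cases h : ∃ a b, t < denseSeq ℝ≥0 a ∧ denseSeq ℝ≥0 a < denseSeq ℝ≥0 b ∧
      denseSeq ℝ≥0 b < t + r ∧ g a ≠ g b
  · obtain ⟨a, b, hta, hab, hb, hne⟩ := h
    refine ⟨g a, denseSeq ℝ≥0 a, hta, fun c htc hca => ?_⟩
    refine (hN c a b hca hab ?_ (hb.trans_le (add_le_add_left htc.le r))).resolve_right hne
    exact hb.le.trans ((add_le_add_right hr1 t).trans hM.le)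
  · push Not at h
    obtain ⟨a, ha1, ha2⟩ := exists_denseSeq_between (lt_add_of_pos_right t hr0)
    refine ⟨g a, t + r, lt_add_of_pos_right t hr0, fun c hc1 hc2 => ?_⟩
    rcases lt_trichotomy (denseSeq ℝ≥0 a) (denseSeq ℝ≥0 c) with hac | hac | hac
    · exact (h a c ha1 hac hc2).symm
    · obtain ⟨N₁, h₁⟩ := hg.2 a
      exact h₁ c hac.le (hac ▸ lt_add_of_pos_right _ (by positivity))
    · exact h c a hc1 hac ha2

/-- An element of `sampleRange` is constant immediately to the left of each positive time. -/
theorem exists_left_limit {g : ℕ → E} (hg : g ∈ sampleRange E) {t : ℝ≥0} (ht : 0 < t) :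
    ∃ (e : E) (v : ℝ≥0), v < t ∧ ∀ a, v < denseSeq ℝ≥0 a → denseSeq ℝ≥0 a < t → g a = e := by
  obtain ⟨M, hM⟩ := exists_nat_gt t
  obtain ⟨N, hN⟩ := hg.1 M
  set r : ℝ≥0 := 1 / ((N : ℝ≥0) + 1) with hr
  have hr0 : 0 < r := by positivity
  have hlt : ∀ u, t - r < u → t < u + r := fun u hu => by
    by_contra! h
    exact hu.not_ge (le_tsub_of_add_le_right h)
  by_cases h : ∃ a b, t - r < denseSeq ℝ≥0 a ∧ denseSeq ℝ≥0 a < denseSeq ℝ≥0 b ∧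
      denseSeq ℝ≥0 b < t ∧ g a ≠ g b
  · obtain ⟨a, b, hta, hab, hb, hne⟩ := h
    refine ⟨g b, denseSeq ℝ≥0 b, hb, fun c hbc hct => ?_⟩
    exact ((hN a b c hab hbc (hct.le.trans hM.le) (hct.trans (hlt _ hta))).resolve_left hne).symm
  · push Not at h
    obtain ⟨a, ha1, ha2⟩ := exists_denseSeq_between (tsub_lt_self ht hr0)
    refine ⟨g a, t - r, tsub_lt_self ht hr0, fun c hc1 hc2 => ?_⟩
    rcases lt_trichotomy (denseSeq ℝ≥0 a) (denseSeq ℝ≥0 c) with hac | hac | hac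
    · exact (h a c ha1 hac hc2).symm
    · obtain ⟨N₁, h₁⟩ := hg.2 a
      exact h₁ c hac.le (hac ▸ lt_add_of_pos_right _ (by positivity))
    · exact h c a hc1 hac ha2

theorem exists_sample_eq {g : ℕ → E} (hg : g ∈ sampleRange E) : ∃ f : JumpPath E, sample f = g := by
  choose F v hv hF using exists_right_limit hg
  -- a constant value of `g` just to the right of `u` is the value of `F` at `u`
  have key : ∀ u w e, u < w → (∀ a, u < denseSeq ℝ≥0 a → denseSeq ℝ≥0 a < w → g a = e) →
      F u = e := by
    intro u w e huw H
    obtain ⟨a, ha1, ha2⟩ := exists_denseSeq_between (lt_min huw (hv u))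
    rw [← H a ha1 (ha2.trans_le (min_le_left _ _)), hF u a ha1 (ha2.trans_le (min_le_right _ _))]
  refine ⟨⟨F, fun t _ => ⟨?_, ?_⟩⟩, ?_⟩
  · filter_upwards [Ico_mem_nhdsGE (hv t)] with u hu
    exact key u (v t) _ hu.2 fun a h1 h2 => hF t a (hu.1.trans_lt h1) h2
  · rcases eq_or_lt_of_le (zero_le (a := t)) with rfl | ht
    · refine ⟨F 0, ?_⟩
      rw [show Iio (0 : ℝ≥0) = ∅ by ext; simp, nhdsWithin_empty]
      exact eventually_bot
    · obtain ⟨e, w, hw, H⟩ := exists_left_limit hg ht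
      refine ⟨e, ?_⟩
      filter_upwards [Ioo_mem_nhdsLT hw] with u hu
      exact key u t e hu.2 fun a h1 h2 => H a (hu.1.trans h1) h2
  · ext n
    obtain ⟨N, hN⟩ := hg.2 n
    exact key _ _ _ (lt_add_of_pos_right _ (by positivity)) fun a h1 h2 => hN a h1.le h2

variable [MeasurableSpace E]

theorem measurable_coord (t : ℝ≥0) : Measurable (coord t : JumpPath E → E) :=
  (measurable_pi_apply t).comp measurable_subtype_coe

variable [Countable E] [DiscreteMeasurableSpace E]

/-- A σ-algebra on the path space that makes the values at times approaching `u` from the right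
measurable makes the value at `u` measurable. -/
theorem measurable_coord_of_dense (mP : MeasurableSpace (JumpPath E)) {u : ℝ≥0} {m : ℕ → ℝ≥0}
    (hm : ∀ n, u < denseSeq ℝ≥0 n → u ≤ m n ∧ m n ≤ denseSeq ℝ≥0 n)
    (hmeas : ∀ n, Measurable[mP] (coord (m n) : JumpPath E → E)) :
    Measurable[mP] (coord u : JumpPath E → E) := by
  refine measurable_to_countable' fun e => ?_
  have : coord u ⁻¹' {e} = ⋃ N : ℕ, ⋂ n, ⋂ (_ : u < denseSeq ℝ≥0 n),
      ⋂ (_ : denseSeq ℝ≥0 n < u + 1 / ((N : ℝ≥0) + 1)), (coord (m n) : JumpPath E → E) ⁻¹' {e} := by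
    ext f
    simp only [mem_preimage, mem_singleton_iff, mem_iUnion, mem_iInter]
    exact f.eq_iff hm e
  rw [this]
  exact MeasurableSet.iUnion fun N => MeasurableSet.iInter fun n => MeasurableSet.iInter fun _ =>
    MeasurableSet.iInter fun _ => hmeas n (MeasurableSet.singleton e)

theorem measurableSet_sampleRange : MeasurableSet (sampleRange E) := by
  have heq : ∀ a b : ℕ, MeasurableSet {g : ℕ → E | g a = g b} := fun a b =>
    measurableSet_eq_fun (measurable_pi_apply a) (measurable_pi_apply b)
  simp only [sampleRange, ofPred_and, ofPred_forall, ofPred_exists, ofPred_or]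
  refine MeasurableSet.inter ?_ ?_
  · refine MeasurableSet.iInter fun M => MeasurableSet.iUnion fun N => MeasurableSet.iInter fun a =>
      MeasurableSet.iInter fun b => MeasurableSet.iInter fun c => MeasurableSet.iInter fun _ =>
      MeasurableSet.iInter fun _ => MeasurableSet.iInter fun _ => MeasurableSet.iInter fun _ =>
      (heq a b).union (heq b c)
  · exact MeasurableSet.iInter fun a => MeasurableSet.iUnion fun N => MeasurableSet.iInter fun b =>
      MeasurableSet.iInter fun _ => MeasurableSet.iInter fun _ => heq b a

theorem measurableEmbedding_sample : MeasurableEmbedding (sample : JumpPath E → ℕ → E) := by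
  rw [MeasurableEmbedding.iff_comap_eq]
  refine ⟨fun f f' h => ?_, ?_, ?_⟩
  · refine Subtype.ext (funext fun u => ?_)
    rw [f.eq_iff (m := denseSeq ℝ≥0) fun n hn => ⟨hn.le, le_rfl⟩]
    obtain ⟨N, hN⟩ := (f'.eq_iff (u := u) (m := denseSeq ℝ≥0) (fun n hn => ⟨hn.le, le_rfl⟩) _).1 rfl
    exact ⟨N, fun n h1 h2 => (congrFun h n).trans (hN n h1 h2)⟩
  · refine le_antisymm ?_ ?_
    · exact (measurable_pi_lambda _ fun n => measurable_coord _).comap_le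
    · set mP := MeasurableSpace.comap (sample : JumpPath E → ℕ → E) inferInstance
      have h : ∀ u, Measurable[mP] (coord u : JumpPath E → E) := fun u =>
        measurable_coord_of_dense mP (m := denseSeq ℝ≥0) (fun n hn => ⟨hn.le, le_rfl⟩) fun n =>
          (measurable_pi_apply n).comp (comap_measurable (sample : JumpPath E → ℕ → E))
      have h2 : Measurable[mP] (fun f : JumpPath E => f.1) := measurable_pi_lambda _ h
      exact (MeasurableSpace.comap_le_iff_le_map.2 h2)
  · have : range (sample : JumpPath E → ℕ → E) = sampleRange E :=
      Subset.antisymm (range_subset_iff.2 sample_mem_sampleRange) fun g hg => exists_sample_eq hg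
    rw [this]
    exact measurableSet_sampleRange

instance : StandardBorelSpace (JumpPath E) := by
  have := measurableEmbedding_sample (E := E)
  have := this.measurableSet_range.standardBorel
  let _ := upgradeStandardBorel (range (sample : JumpPath E → ℕ → E))
  let e := (measurableEmbedding_sample (E := E)).equivRange
  let _ : TopologicalSpace (JumpPath E) := .induced e inferInstance
  have : BorelSpace (JumpPath E) :=
    ⟨by
      rw [borel_comap, ← BorelSpace.measurable_eq (α := range (sample : JumpPath E → ℕ → E))]
      exact e.measurableEmbedding.comap_eq.symm⟩
  have : PolishSpace (JumpPath E) := e.toEquiv.polishSpace_induced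
  infer_instance

instance [Nonempty E] : Nonempty (JumpPath E) :=
  ⟨⟨fun _ => Classical.arbitrary E, fun _ _ => ⟨by simp, Classical.arbitrary E, by simp⟩⟩⟩

end JumpPath

/-! ### The absorption time -/

section Absorption

open TopologicalSpace (denseSeq)

variable {p : ℕ}

instance : DiscreteMeasurableSpace (Fin p ⊕ Unit) :=
  ⟨fun _ => measurableSet_sum_iff.2 ⟨.of_discrete, .of_discrete⟩⟩

theorem ne_of_lt_absorptionTime {f : JumpPath (Fin p ⊕ Unit)} {t : ℝ≥0}
    (h : (t : ℝ≥0∞) < absorptionTime coord f) : coord t f ≠ Sum.inr () := fun ht =>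
  h.not_ge (sInf_le ⟨t, rfl, ht⟩)

/-- By right-continuity, a finite absorption time is attained. -/
theorem coord_absorptionTime {f : JumpPath (Fin p ⊕ Unit)} {t : ℝ≥0}
    (h : absorptionTime coord f = t) : coord t f = Sum.inr () := by
  obtain ⟨N, hN⟩ := f.exists_right t
  have : absorptionTime coord f < ((t + 1 / ((N : ℝ≥0) + 1) : ℝ≥0) : ℝ≥0∞) := by
    rw [h]
    exact ENNReal.coe_lt_coe.2 (lt_add_of_pos_right _ (by positivity))
  obtain ⟨_, ⟨u, rfl, hu⟩, hlt⟩ := sInf_lt_iff.1 this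
  rw [← hu]
  refine (hN u ?_ (ENNReal.coe_lt_coe.1 hlt)).symm
  rw [← ENNReal.coe_le_coe, ← h]
  exact sInf_le ⟨u, rfl, hu⟩

theorem absorptionTime_lt_iff {f : JumpPath (Fin p ⊕ Unit)} {a : ℝ≥0∞} :
    absorptionTime coord f < a ↔
      ∃ n, (denseSeq ℝ≥0 n : ℝ≥0∞) < a ∧ coord (denseSeq ℝ≥0 n) f = Sum.inr () := by
  constructor
  · intro h
    obtain ⟨t, ht⟩ := ENNReal.lt_iff_exists_coe.1 h |>.imp fun t ht => ht.1
    have habs := coord_absorptionTime ht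
    obtain ⟨N, hN⟩ := f.exists_right t
    rw [ht] at h
    obtain ⟨b, hb1, hb2⟩ := ENNReal.lt_iff_exists_nnreal_btwn.1 h
    obtain ⟨n, h1, h2⟩ := exists_denseSeq_between (s := t) (t := min b (t + 1 / ((N : ℝ≥0) + 1)))
      (lt_min (ENNReal.coe_lt_coe.1 hb1) (lt_add_of_pos_right _ (by positivity)))
    exact ⟨n, (ENNReal.coe_lt_coe.2 (h2.trans_le (min_le_left _ _))).trans hb2,
      (hN _ h1.le (h2.trans_le (min_le_right _ _))).trans habs⟩
  · rintro ⟨n, hn, habs⟩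
    exact (sInf_le ⟨_, rfl, habs⟩ : absorptionTime coord f ≤ _).trans_lt hn

theorem measurable_absorptionTime :
    Measurable (absorptionTime (coord : ℝ≥0 → JumpPath (Fin p ⊕ Unit) → _)) := by
  refine measurable_of_Iio fun a => ?_
  have : absorptionTime (coord : ℝ≥0 → JumpPath (Fin p ⊕ Unit) → _) ⁻¹' Iio a =
      ⋃ n, ⋃ (_ : (denseSeq ℝ≥0 n : ℝ≥0∞) < a), coord (denseSeq ℝ≥0 n) ⁻¹' {Sum.inr ()} := by
    ext f
    simp only [mem_preimage, mem_Iio, mem_iUnion, mem_singleton_iff, absorptionTime_lt_iff,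
      exists_prop]
  rw [this]
  exact MeasurableSet.iUnion fun n => MeasurableSet.iUnion fun _ =>
    measurable_coord _ (MeasurableSet.singleton _)

end Absorption

section PathLaw

/-! ### The law of the path and the absorption time -/

variable {p : ℕ} {π : Fin p → ℝ} {T : ℝ → Matrix (Fin p) (Fin p) ℝ}

/-- `L` is the law of the path of a Markov jump process with initial distribution `(π, 0)` and
intensity matrix function `fullIntensity T`; the Markov property is stated with events of the past
instead of conditional expectations. -/
structure IsPathLaw (π : Fin p → ℝ) (T : ℝ → Matrix (Fin p) (Fin p) ℝ)
    (L : Measure (JumpPath (Fin p ⊕ Unit))) : Prop where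
  initial_inl : ∀ i, L.real (coord 0 ⁻¹' {Sum.inl i}) = π i
  initial_inr : L (coord 0 ⁻¹' {Sum.inr ()}) = 0
  markov : ∀ s t : ℝ≥0, s ≤ t → ∀ A, MeasurableSet[pastSigma coord s] A → ∀ a b,
    L.real (A ∩ coord s ⁻¹' {a} ∩ coord t ⁻¹' {b}) =
      L.real (A ∩ coord s ⁻¹' {a}) * prodIntegral (fullIntensity T) s t a b

theorem pastSigma_coord_le {E : Type*} [MeasurableSpace E] (s : ℝ≥0) :
    pastSigma (coord : ℝ≥0 → JumpPath E → E) s ≤ instMeasurableSpaceJumpPath :=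
  iSup_le fun u => iSup_le fun _ => (measurable_coord u).comap_le

theorem measurable_coord_pastSigma {E : Type*} [MeasurableSpace E] {u s : ℝ≥0} (hus : u ≤ s) :
    Measurable[pastSigma (coord : ℝ≥0 → JumpPath E → E) s] (coord u : JumpPath E → E) :=
  Measurable.of_comap_le (le_iSup_of_le u (le_iSup_of_le hus le_rfl))

theorem measurableSet_coord_preimage (t : ℝ≥0) (a : Fin p ⊕ Unit) :
    MeasurableSet (coord t ⁻¹' {a} : Set (JumpPath (Fin p ⊕ Unit))) :=
  measurable_coord t (MeasurableSet.singleton a)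

/-- The law on the line of the absorption time on the part of the event `C` where it is finite. -/
noncomputable def absorbedLaw (L : Measure (JumpPath (Fin p ⊕ Unit)))
    (C : Set (JumpPath (Fin p ⊕ Unit))) : Measure ℝ :=
  (L.restrict (C ∩ {f | absorptionTime coord f ≠ ⊤})).map fun f => (absorptionTime coord f).toReal

theorem measurable_absorptionTime_toReal :
    Measurable fun f : JumpPath (Fin p ⊕ Unit) => (absorptionTime coord f).toReal :=
  measurable_absorptionTime.ennreal_toReal

theorem measurableSet_absorptionTime_ne_top :
    MeasurableSet {f : JumpPath (Fin p ⊕ Unit) | absorptionTime coord f ≠ ⊤} :=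
  (measurable_absorptionTime (MeasurableSet.singleton ⊤)).compl

variable {L : Measure (JumpPath (Fin p ⊕ Unit))}

theorem absorbedLaw_apply {C : Set (JumpPath (Fin p ⊕ Unit))} {B : Set ℝ} (hB : MeasurableSet B) :
    absorbedLaw L C B = L (((fun f => (absorptionTime coord f).toReal) ⁻¹' B) ∩
      (C ∩ {f | absorptionTime coord f ≠ ⊤})) := by
  rw [absorbedLaw, Measure.map_apply measurable_absorptionTime_toReal hB,
    Measure.restrict_apply (measurable_absorptionTime_toReal hB)]

instance [IsFiniteMeasure L] (C : Set (JumpPath (Fin p ⊕ Unit))) :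
    IsFiniteMeasure (absorbedLaw L C) := by
  unfold absorbedLaw
  infer_instance

/-- The past up to time `s` is generated by the path stopped at `s`, sampled along a dense
sequence. -/
theorem pastSigma_eq_comap {E : Type*} [MeasurableSpace E] [Countable E]
    [DiscreteMeasurableSpace E] (s : ℝ≥0) :
    pastSigma (coord : ℝ≥0 → JumpPath E → E) s = MeasurableSpace.comap
      (fun f n => coord (min (TopologicalSpace.denseSeq ℝ≥0 n) s) f)
      (inferInstance : MeasurableSpace (ℕ → E)) := by
  refine le_antisymm (iSup_le fun u => iSup_le fun hus => ?_) ?_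
  · rw [← measurable_iff_comap_le]
    refine measurable_coord_of_dense _ (m := fun n => min (TopologicalSpace.denseSeq ℝ≥0 n) s)
      (fun n hn => ⟨le_min hn.le hus, min_le_left _ _⟩) fun n => ?_
    exact (measurable_pi_apply (X := fun _ => E) n).comp (comap_measurable _)
  · rw [← measurable_iff_comap_le]
    refine @measurable_pi_lambda _ _ _ (pastSigma coord s) _ _ fun n => ?_
    exact measurable_coord_pastSigma (min_le_right _ _)

theorem sum_measure_inter_coord (L : Measure (JumpPath (Fin p ⊕ Unit))) (t : ℝ≥0)
    (G : Set (JumpPath (Fin p ⊕ Unit))) : ∑ a, L (coord t ⁻¹' {a} ∩ G) = L G := by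
  have h := sum_measure_preimage_singleton (μ := L.restrict G) Finset.univ (f := coord t)
    fun a _ => measurableSet_coord_preimage t a
  simpa [Measure.restrict_apply (measurableSet_coord_preimage t _)] using h

namespace IsPathLaw

variable [IsProbabilityMeasure L]

theorem measure_inr_inter_inl (hL : IsPathLaw π T L) (hT : IsSubIntensity T) {s t : ℝ≥0}
    (hst : s ≤ t) (j : Fin p) : L (coord s ⁻¹' {Sum.inr ()} ∩ coord t ⁻¹' {Sum.inl j}) = 0 := by
  have h := hL.markov s t hst univ MeasurableSet.univ (Sum.inr ()) (Sum.inl j)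
  rw [prodIntegral_fullIntensity_inr_inl hT s.coe_nonneg (NNReal.coe_le_coe.2 hst), mul_zero,
    univ_inter, measureReal_eq_zero_iff] at h
  exact h

/-- Almost surely, absorption has happened by time `t` exactly if the process is in the absorbing
state at time `t`. -/
theorem ae_absorptionTime_le_iff (hL : IsPathLaw π T L) (hT : IsSubIntensity T) (t : ℝ≥0) :
    ∀ᵐ f ∂L, absorptionTime coord f ≤ t ↔ coord t f = Sum.inr () := by
  have h : ∀ᵐ f ∂L, ∀ n, TopologicalSpace.denseSeq ℝ≥0 n ≤ t → ∀ j,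
      ¬ (coord (TopologicalSpace.denseSeq ℝ≥0 n) f = Sum.inr () ∧ coord t f = Sum.inl j) := by
    refine ae_all_iff.2 fun n => ?_
    by_cases hn : TopologicalSpace.denseSeq ℝ≥0 n ≤ t
    · simp only [hn, forall_const]
      refine ae_all_iff.2 fun j => ?_
      rw [ae_iff]
      simpa only [not_not] using! hL.measure_inr_inter_inl hT hn j
    · exact ae_of_all _ fun f h => absurd h hn
  filter_upwards [h] with f hf
  constructor
  · intro hle
    rcases hle.eq_or_lt with heq | hlt
    · exact coord_absorptionTime heq
    · obtain ⟨n, hn, habs⟩ := absorptionTime_lt_iff.1 hlt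
      have := hf n (ENNReal.coe_le_coe.1 hn.le)
      rcases ht : coord t f with j | j
      · exact absurd ⟨habs, ht⟩ (this j)
      · rfl
  · intro habs
    exact sInf_le ⟨t, rfl, habs⟩

theorem absorbedLaw_Iic (hL : IsPathLaw π T L) (hT : IsSubIntensity T)
    (C : Set (JumpPath (Fin p ⊕ Unit))) (t : ℝ≥0) :
    absorbedLaw L C (Iic (t : ℝ)) = L (C ∩ coord t ⁻¹' {Sum.inr ()}) := by
  rw [absorbedLaw_apply measurableSet_Iic]
  refine measure_congr ?_
  filter_upwards [hL.ae_absorptionTime_le_iff hT t] with f hf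
  refine propext ?_
  change ((absorptionTime coord f).toReal ≤ t ∧ f ∈ C ∧ absorptionTime coord f ≠ ⊤) ↔
    f ∈ C ∧ coord t f = Sum.inr ()
  rw [← hf]
  constructor
  · rintro ⟨h1, h2, h3⟩
    refine ⟨h2, ?_⟩
    rw [← ENNReal.ofReal_toReal h3, ← ENNReal.ofReal_coe_nnreal]
    exact ENNReal.ofReal_le_ofReal h1
  · rintro ⟨h1, h2⟩
    exact ⟨ENNReal.toReal_le_coe_of_le_coe h2, h1, ne_top_of_le_ne_top ENNReal.coe_ne_top h2⟩

end IsPathLaw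

theorem absorbedLaw_Iic_of_neg (C : Set (JumpPath (Fin p ⊕ Unit))) {a : ℝ} (ha : a < 0) :
    absorbedLaw L C (Iic a) = 0 := by
  rw [absorbedLaw_apply measurableSet_Iic]
  convert measure_empty (μ := L)
  refine eq_empty_of_forall_notMem fun f hf => ?_
  have : (absorptionTime coord f).toReal ≤ a := hf.1
  linarith [ENNReal.toReal_nonneg (a := absorptionTime coord f)]

theorem absorbRate_nonneg (hT : IsSubIntensity T) {s u : ℝ} (hs : 0 ≤ s) (hsu : s ≤ u)
    (i : Fin p) : 0 ≤ absorbRate T s i u := by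
  rw [← absorbDensity_eq_absorbRate hT hs hsu]
  exact absorbDensity_nonneg hT hs hsu i

theorem aemeasurable_absorbRate (hT : IsSubIntensity T) (s : ℝ) (i : Fin p) (c : ℝ≥0∞) :
    AEMeasurable ((Ioi s).indicator fun u => c * ENNReal.ofReal (absorbRate T s i u)) volume := by
  have hloc : LocallyIntegrable (absorbRate T s i) volume := by
    intro t
    refine ⟨Ioc (t - 1) (t + 1), Ioc_mem_nhds (by linarith) (by linarith), ?_⟩
    exact (intervalIntegrable_iff_integrableOn_Ioc_of_le (by linarith)).1
      (locInt_absorbRate hT s i _ _)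
  exact ((hloc.aestronglyMeasurable.aemeasurable.ennreal_ofReal).const_mul c).indicator
    measurableSet_Ioi

/-- After time `s`, from the state `i`, the absorption time has the density `absorbRate T s i`,
independently of the past. -/
theorem IsPathLaw.absorbedLaw_eq [IsProbabilityMeasure L] (hL : IsPathLaw π T L)
    (hT : IsSubIntensity T) (s : ℝ≥0) {A : Set (JumpPath (Fin p ⊕ Unit))}
    (hA : MeasurableSet[pastSigma coord s] A) (i : Fin p) :
    absorbedLaw L (A ∩ coord s ⁻¹' {Sum.inl i}) = volume.withDensity ((Ioi (s : ℝ)).indicator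
      fun u => L (A ∩ coord s ⁻¹' {Sum.inl i}) * ENNReal.ofReal (absorbRate T s i u)) := by
  refine Measure.ext_of_Iic _ _ fun a => ?_
  rw [withDensity_apply _ measurableSet_Iic, lintegral_indicator measurableSet_Ioi,
    Measure.restrict_restrict measurableSet_Ioi, Ioi_inter_Iic]
  rcases le_total a s with has | hsa
  · rw [Ioc_eq_empty (not_lt.2 has), Measure.restrict_empty, lintegral_zero_measure]
    rcases lt_or_ge a 0 with ha | ha
    · exact absorbedLaw_Iic_of_neg _ ha
    · lift a to ℝ≥0 using ha
      rw [hL.absorbedLaw_Iic hT]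
      refine measure_mono_null ?_ (hL.measure_inr_inter_inl hT (NNReal.coe_le_coe.1 has) i)
      exact fun f hf => ⟨hf.2, hf.1.2⟩
  · lift a to ℝ≥0 using s.coe_nonneg.trans hsa
    have hsa' := NNReal.coe_le_coe.1 hsa
    rw [hL.absorbedLaw_Iic hT, lintegral_const_mul', ← ofReal_integral_eq_lintegral_ofReal,
      ← intervalIntegral.integral_of_le hsa, ← prodIntegral_fullIntensity_inl_inr hT s.coe_nonneg hsa,
      ← ENNReal.toReal_eq_toReal_iff' (measure_ne_top _ _) (ENNReal.mul_ne_top (measure_ne_top _ _)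
      ENNReal.ofReal_ne_top), ENNReal.toReal_mul, ENNReal.toReal_ofReal]
    · exact hL.markov s a hsa' A hA _ _
    · rw [prodIntegral_fullIntensity_inl_inr hT s.coe_nonneg hsa]
      exact intervalIntegral.integral_nonneg hsa fun u hu => absorbRate_nonneg hT s.coe_nonneg hu.1 i
    · exact (locInt_absorbRate hT s i s a).1
    · filter_upwards [ae_restrict_mem measurableSet_Ioc] with u hu
      exact absorbRate_nonneg hT s.coe_nonneg hu.1.le i
    · exact measure_ne_top _ _

/-- The density of the absorption time, set to zero at nonpositive times. -/
noncomputable def absorbedDensity (π : Fin p → ℝ) (T : ℝ → Matrix (Fin p) (Fin p) ℝ) : ℝ → ℝ≥0∞ :=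
  (Ioi 0).indicator fun u => ENNReal.ofReal (iphDensity π T u)

theorem absorbedDensity_eq_sum (hT : IsSubIntensity T) (hπ : ∀ i, 0 ≤ π i) (u : ℝ) :
    absorbedDensity π T u =
      ∑ i, (Ioi 0).indicator (fun u => ENNReal.ofReal (π i) * ENNReal.ofReal (absorbRate T 0 i u)) u
      := by
  by_cases hu : 0 < u
  · simp only [absorbedDensity, indicator_of_mem (mem_Ioi.2 hu)]
    rw [iphDensity, dotProduct, ENNReal.ofReal_sum_of_nonneg fun i _ =>
      mul_nonneg (hπ i) (absorbDensity_nonneg hT le_rfl hu.le i)]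
    refine Finset.sum_congr rfl fun i _ => ?_
    rw [ENNReal.ofReal_mul (hπ i), absorbDensity_eq_absorbRate hT le_rfl hu.le]
  · have : u ∉ Ioi (0 : ℝ) := hu
    simp [absorbedDensity, indicator_of_notMem this]

theorem aemeasurable_absorbedDensity (hT : IsSubIntensity T) (hπ : ∀ i, 0 ≤ π i) :
    AEMeasurable (absorbedDensity π T) volume := by
  have : absorbedDensity π T = fun u => ∑ i, (Ioi 0).indicator
      (fun u => ENNReal.ofReal (π i) * ENNReal.ofReal (absorbRate T 0 i u)) u :=
    funext (absorbedDensity_eq_sum hT hπ)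
  rw [this]
  exact Finset.aemeasurable_fun_sum _ fun i _ => aemeasurable_absorbRate hT 0 i _

theorem IsPathLaw.initial_nonneg (hL : IsPathLaw π T L) (i : Fin p) : 0 ≤ π i :=
  hL.initial_inl i ▸ measureReal_nonneg

/-- The absorption time has the density `iphDensity π T`, by summation over the initial states. -/
theorem IsPathLaw.absorbedLaw_univ [IsProbabilityMeasure L] (hL : IsPathLaw π T L)
    (hT : IsSubIntensity T) : absorbedLaw L univ = volume.withDensity (absorbedDensity π T) := by
  ext B hB
  have h1 : ∀ i, absorbedLaw L (coord 0 ⁻¹' {Sum.inl i}) B = ∫⁻ u in B, (Ioi 0).indicator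
      (fun u => ENNReal.ofReal (π i) * ENNReal.ofReal (absorbRate T 0 i u)) u := by
    intro i
    have := hL.absorbedLaw_eq hT 0 MeasurableSet.univ i
    rw [univ_inter] at this
    rw [this, withDensity_apply _ hB, ← hL.initial_inl i, ofReal_measureReal]
    rfl
  rw [withDensity_apply _ hB]
  simp_rw [absorbedDensity_eq_sum hT hL.initial_nonneg]
  rw [lintegral_finsetSum' _ fun i _ => (aemeasurable_absorbRate hT 0 i _).restrict]
  simp_rw [← h1, absorbedLaw_apply hB]
  rw [← sum_measure_inter_coord L 0, Fintype.sum_sum_type]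
  simp only [Finset.univ_unique, PUnit.default_eq_unit, Finset.sum_singleton]
  rw [measure_mono_null inter_subset_left hL.initial_inr, add_zero]
  refine Finset.sum_congr rfl fun i _ => ?_
  congr 1
  ext f
  simp only [mem_inter_iff, mem_univ, true_and]
  tauto

end PathLaw

section Disintegration

/-! ### Conditioning on the absorption time -/

open TopologicalSpace (denseSeq)

variable {p : ℕ} {π : Fin p → ℝ} {T : ℝ → Matrix (Fin p) (Fin p) ℝ}
  {L : Measure (JumpPath (Fin p ⊕ Unit))} [IsProbabilityMeasure L]
  {κ : Kernel ℝ≥0∞ (JumpPath (Fin p ⊕ Unit))} [IsMarkovKernel κ]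

theorem map_absorptionTime_prod_apply {B : Set ℝ≥0∞} (hB : MeasurableSet B)
    {C : Set (JumpPath (Fin p ⊕ Unit))} (hC : MeasurableSet C)
    (hκ : L.map (fun f => (absorptionTime coord f, f)) = (L.map (absorptionTime coord)) ⊗ₘ κ) :
    ∫⁻ y in B, κ y C ∂(L.map (absorptionTime coord)) = L (absorptionTime coord ⁻¹' B ∩ C) := by
  rw [← Measure.compProd_apply_prod hB hC, ← hκ,
    Measure.map_apply (measurable_absorptionTime.prodMk measurable_id') (hB.prod hC)]
  rfl

/-- Disintegration of the law of the path, on the event that absorption happens. -/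
theorem absorbedLaw_univ_withDensity
    (hκ : L.map (fun f => (absorptionTime coord f, f)) = (L.map (absorptionTime coord)) ⊗ₘ κ)
    {C : Set (JumpPath (Fin p ⊕ Unit))} (hC : MeasurableSet C) :
    (absorbedLaw L univ).withDensity (fun x => κ (ENNReal.ofReal x) C) = absorbedLaw L C := by
  have hmeas : Measurable fun x : ℝ => κ (ENNReal.ofReal x) C :=
    (κ.measurable_coe hC).comp ENNReal.measurable_ofReal
  ext B hB
  have hpre := measurable_absorptionTime_toReal (p := p) hB
  have hfin := measurableSet_absorptionTime_ne_top (p := p)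
  rw [withDensity_apply _ hB, absorbedLaw, setLIntegral_map hB hmeas
    measurable_absorptionTime_toReal, Measure.restrict_restrict hpre, univ_inter,
    absorbedLaw_apply hB]
  set B' : Set ℝ≥0∞ := ENNReal.toReal ⁻¹' B ∩ {⊤}ᶜ
  have hB' : MeasurableSet B' :=
    (ENNReal.measurable_toReal hB).inter (MeasurableSet.singleton ⊤).compl
  have hset : (fun f : JumpPath (Fin p ⊕ Unit) => (absorptionTime coord f).toReal) ⁻¹' B ∩
      {f | absorptionTime coord f ≠ ⊤} = absorptionTime coord ⁻¹' B' := rfl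
  rw [setLIntegral_congr_fun (g := fun f => κ (absorptionTime coord f) C) (hpre.inter hfin)
    fun f hf => by simp only [ENNReal.ofReal_toReal hf.2], hset,
    ← setLIntegral_map hB' (κ.measurable_coe hC) measurable_absorptionTime,
    map_absorptionTime_prod_apply hB' hC hκ, ← hset]
  congr 1
  ext f
  simp only [mem_inter_iff]
  tauto

/-- The comparison of densities for a single time `s` and a single event of the past. -/
theorem ae_absorbedDensity_mul (hL : IsPathLaw π T L) (hT : IsSubIntensity T)
    (hκ : L.map (fun f => (absorptionTime coord f, f)) = (L.map (absorptionTime coord)) ⊗ₘ κ)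
    (s : ℝ≥0) {A : Set (JumpPath (Fin p ⊕ Unit))} (hA : MeasurableSet[pastSigma coord s] A)
    (i : Fin p) : ∀ᵐ x : ℝ, s < x →
      ENNReal.ofReal (iphDensity π T x) * κ (ENNReal.ofReal x) (A ∩ coord s ⁻¹' {Sum.inl i}) =
        ENNReal.ofReal (absorbDensity T x s i) * L (A ∩ coord s ⁻¹' {Sum.inl i}) := by
  have hC : MeasurableSet (A ∩ coord s ⁻¹' {Sum.inl i}) :=
    (pastSigma_coord_le s A hA).inter (measurableSet_coord_preimage s _)
  have h := absorbedLaw_univ_withDensity hκ hC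
  have hmeas : Measurable fun x : ℝ => κ (ENNReal.ofReal x) (A ∩ coord s ⁻¹' {Sum.inl i}) :=
    (κ.measurable_coe hC).comp ENNReal.measurable_ofReal
  have hd := aemeasurable_absorbedDensity hT hL.initial_nonneg
  rw [hL.absorbedLaw_univ hT, hL.absorbedLaw_eq hT s hA i,
    ← withDensity_mul₀ hd hmeas.aemeasurable,
    withDensity_eq_iff_of_sigmaFinite (hd.mul hmeas.aemeasurable)
      (aemeasurable_absorbRate hT s i _)] at h
  filter_upwards [h] with x hx hsx
  have h0x : (0 : ℝ) < x := s.coe_nonneg.trans_lt hsx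
  rw [Pi.mul_apply, absorbedDensity, indicator_of_mem (mem_Ioi.2 h0x),
    indicator_of_mem (mem_Ioi.2 hsx)] at hx
  rw [hx, absorbDensity_eq_absorbRate hT s.coe_nonneg hsx.le, mul_comm]

theorem measurableSet_of_mem_generateSetAlgebra {α : Type*} [MeasurableSpace α]
    [MeasurableSpace.CountablyGenerated α] {G : Set α}
    (hG : G ∈ generateSetAlgebra (MeasurableSpace.countableGeneratingSet α)) : MeasurableSet G := by
  rw [← MeasurableSpace.generateFrom_countableGeneratingSet (α := α),
    ← generateFrom_generateSetAlgebra_eq]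
  exact MeasurableSpace.measurableSet_generateFrom hG

/-- Two finite measures on the path space that agree, on the event `D`, on a generating algebra of
the past agree there on the whole past. -/
theorem measure_inter_eq_of_generateSetAlgebra {E : Type*} [MeasurableSpace E] [Countable E]
    [DiscreteMeasurableSpace E] {μ ν : Measure (JumpPath E)} [IsFiniteMeasure μ] (s : ℝ≥0)
    {D : Set (JumpPath E)} (h : ∀ G ∈ generateSetAlgebra
      (MeasurableSpace.countableGeneratingSet (ℕ → E)),
      μ ((fun f n => coord (min (denseSeq ℝ≥0 n) s) f) ⁻¹' G ∩ D) =
        ν ((fun f n => coord (min (denseSeq ℝ≥0 n) s) f) ⁻¹' G ∩ D))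
    {A : Set (JumpPath E)} (hA : MeasurableSet[pastSigma coord s] A) : μ (A ∩ D) = ν (A ∩ D) := by
  set ρ : JumpPath E → ℕ → E := fun f n => coord (min (denseSeq ℝ≥0 n) s) f
  have hρ : Measurable ρ := measurable_pi_lambda _ fun n => measurable_coord _
  have halg := isSetAlgebra_generateSetAlgebra
    (𝒜 := MeasurableSpace.countableGeneratingSet (ℕ → E))
  have happ : ∀ (μ : Measure (JumpPath E)) (G : Set (ℕ → E)), MeasurableSet G →
      ((μ.restrict D).map ρ) G = μ (ρ ⁻¹' G ∩ D) := fun μ G hG => by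
    rw [Measure.map_apply hρ hG, Measure.restrict_apply (hρ hG)]
  have hgen : (inferInstance : MeasurableSpace (ℕ → E)) = MeasurableSpace.generateFrom
      (generateSetAlgebra (MeasurableSpace.countableGeneratingSet (ℕ → E))) := by
    rw [generateFrom_generateSetAlgebra_eq, MeasurableSpace.generateFrom_countableGeneratingSet]
  have heq : (μ.restrict D).map ρ = (ν.restrict D).map ρ := by
    refine ext_of_generate_finite _ hgen (fun G hG G' hG' _ => halg.inter_mem hG hG')
      (fun G hG => ?_) ?_
    · rw [happ μ G (measurableSet_of_mem_generateSetAlgebra hG),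
        happ ν G (measurableSet_of_mem_generateSetAlgebra hG)]
      exact h G hG
    · rw [happ μ _ MeasurableSet.univ, happ ν _ MeasurableSet.univ]
      exact h univ halg.univ_mem
  rw [pastSigma_eq_comap] at hA
  obtain ⟨G, hG, rfl⟩ := hA
  rw [← happ μ G hG, heq, happ ν G hG]

/-- Right-continuity of the one-dimensional marginals on an event, by right-continuity of the paths. -/
theorem tendsto_measure_inter_coord {E : Type*} [MeasurableSpace E] [DiscreteMeasurableSpace E]
    (μ : Measure (JumpPath E)) [IsFiniteMeasure μ] {A : Set (JumpPath E)} (hA : MeasurableSet A)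
    {s : ℝ≥0} {u : ℕ → ℝ≥0} (hu : Tendsto u atTop (𝓝[≥] s)) (e : E) :
    Tendsto (fun k => μ (A ∩ coord (u k) ⁻¹' {e})) atTop (𝓝 (μ (A ∩ coord s ⁻¹' {e}))) := by
  refine tendsto_measure_of_tendsto_indicator_of_isFiniteMeasure atTop μ
    (fun k => hA.inter (measurable_coord _ (MeasurableSet.singleton e))) fun f => ?_
  filter_upwards [hu.eventually (f.2 s ENNReal.coe_lt_top).1] with k hk
  simp only [mem_inter_iff, mem_preimage, mem_singleton_iff]
  change (f ∈ A ∧ f.1 (u k) = e) ↔ (f ∈ A ∧ f.1 s = e)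
  rw [hk]

/-- The conditional law given absorption at time `x`, restricted to the past of a time `s < x`, is
the Doob transform of the unconditional law by `absorbDensity T x s`. -/
theorem ae_density_mul_kernel (hL : IsPathLaw π T L) (hT : IsSubIntensity T)
    (hκ : L.map (fun f => (absorptionTime coord f, f)) = (L.map (absorptionTime coord)) ⊗ₘ κ) :
    ∀ᵐ x : ℝ, ∀ s : ℝ≥0, s < x → ∀ A, MeasurableSet[pastSigma coord s] A → ∀ i,
      ENNReal.ofReal (iphDensity π T x) * κ (ENNReal.ofReal x) (A ∩ coord s ⁻¹' {Sum.inl i}) =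
        ENNReal.ofReal (absorbDensity T x s i) * L (A ∩ coord s ⁻¹' {Sum.inl i}) := by
  set 𝒢 := generateSetAlgebra (MeasurableSpace.countableGeneratingSet (ℕ → Fin p ⊕ Unit))
  have hcount : 𝒢.Countable :=
    countable_generateSetAlgebra MeasurableSpace.countable_countableGeneratingSet
  have hpre : ∀ (s : ℝ≥0), ∀ G ∈ 𝒢, MeasurableSet[pastSigma coord s]
      ((fun (f : JumpPath (Fin p ⊕ Unit)) n => coord (min (denseSeq ℝ≥0 n) s) f) ⁻¹' G) :=
    fun s G hG => by
      rw [pastSigma_eq_comap]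
      exact ⟨G, measurableSet_of_mem_generateSetAlgebra hG, rfl⟩
  -- countably many times and events
  have h : ∀ᵐ x : ℝ, ∀ n, ∀ G ∈ 𝒢, ∀ i, denseSeq ℝ≥0 n < x →
      ENNReal.ofReal (iphDensity π T x) * κ (ENNReal.ofReal x)
        ((fun f k => coord (min (denseSeq ℝ≥0 k) (denseSeq ℝ≥0 n)) f) ⁻¹' G ∩
          coord (denseSeq ℝ≥0 n) ⁻¹' {Sum.inl i}) =
        ENNReal.ofReal (absorbDensity T x (denseSeq ℝ≥0 n) i) *
          L ((fun f k => coord (min (denseSeq ℝ≥0 k) (denseSeq ℝ≥0 n)) f) ⁻¹' G ∩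
            coord (denseSeq ℝ≥0 n) ⁻¹' {Sum.inl i}) :=
    ae_all_iff.2 fun n => (ae_ball_iff hcount).2 fun G hG => ae_all_iff.2 fun i =>
      ae_absorbedDensity_mul hL hT hκ _ (hpre _ G hG) i
  filter_upwards [h] with x hx
  -- all events of the past of countably many times
  have hx' : ∀ n, denseSeq ℝ≥0 n < x → ∀ A, MeasurableSet[pastSigma coord (denseSeq ℝ≥0 n)] A →
      ∀ i, ENNReal.ofReal (iphDensity π T x) *
        κ (ENNReal.ofReal x) (A ∩ coord (denseSeq ℝ≥0 n) ⁻¹' {Sum.inl i}) =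
        ENNReal.ofReal (absorbDensity T x (denseSeq ℝ≥0 n) i) *
          L (A ∩ coord (denseSeq ℝ≥0 n) ⁻¹' {Sum.inl i}) := by
    intro n hn A hA i
    have hfin : IsFiniteMeasure (ENNReal.ofReal (iphDensity π T x) • κ (ENNReal.ofReal x)) :=
      Measure.smul_finite _ ENNReal.ofReal_ne_top
    exact measure_inter_eq_of_generateSetAlgebra
      (μ := ENNReal.ofReal (iphDensity π T x) • κ (ENNReal.ofReal x))
      (ν := ENNReal.ofReal (absorbDensity T x (denseSeq ℝ≥0 n) i) • L) (denseSeq ℝ≥0 n)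
      (fun G hG => hx n G hG i hn) hA
  -- approximation of `s` from the right
  intro s hsx A hA i
  lift x to ℝ≥0 using s.coe_nonneg.trans hsx.le
  rw [NNReal.coe_lt_coe] at hsx
  have hseq : ∀ k : ℕ, ∃ n, s < denseSeq ℝ≥0 n ∧
      denseSeq ℝ≥0 n < min x (s + 1 / ((k : ℝ≥0) + 1)) := fun k =>
    exists_denseSeq_between (lt_min hsx (lt_add_of_pos_right _ (by positivity)))
  choose n hn1 hn2 using hseq
  have hu : Tendsto (fun k => denseSeq ℝ≥0 (n k)) atTop (𝓝 s) := by
    refine tendsto_of_tendsto_of_tendsto_of_le_of_le tendsto_const_nhds (h :=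
      fun k : ℕ => s + 1 / ((k : ℝ≥0) + 1)) ?_ (fun k => (hn1 k).le)
      fun k => ((hn2 k).trans_le (min_le_right _ _)).le
    simpa using (tendsto_one_div_add_atTop_nhds_zero_nat (𝕜 := ℝ≥0)).const_add s
  have hu' : Tendsto (fun k => denseSeq ℝ≥0 (n k)) atTop (𝓝[≥] s) :=
    tendsto_nhdsWithin_iff.2 ⟨hu, Eventually.of_forall fun k => (hn1 k).le⟩
  have hd : Tendsto (fun k => absorbDensity T x (denseSeq ℝ≥0 (n k)) i) atTop
      (𝓝 (absorbDensity T x s i)) := by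
    rw [absorbDensity_eq_backward hT s.coe_nonneg (NNReal.coe_le_coe.2 hsx.le)]
    refine (((hasAEDeriv_backward hT.locInt i).continuous.comp
      NNReal.continuous_coe).tendsto s |>.comp hu).congr fun k => ?_
    rw [absorbDensity_eq_backward hT (NNReal.coe_nonneg _)
      (NNReal.coe_le_coe.2 ((hn2 k).trans_le (min_le_left _ _)).le)]
    rfl
  have hA' := pastSigma_coord_le s A hA
  have hl := ENNReal.Tendsto.const_mul (a := ENNReal.ofReal (iphDensity π T x))
    (tendsto_measure_inter_coord (κ (ENNReal.ofReal x)) hA' hu' (Sum.inl i))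
    (Or.inr ENNReal.ofReal_ne_top)
  have hr := ENNReal.Tendsto.mul (ENNReal.tendsto_ofReal hd)
    (Or.inr (measure_ne_top L _)) (tendsto_measure_inter_coord L hA' hu' (Sum.inl i))
    (Or.inr ENNReal.ofReal_ne_top)
  refine tendsto_nhds_unique hl (hr.congr fun k => (hx' (n k) ?_ A ?_ i).symm)
  · exact NNReal.coe_lt_coe.2 ((hn2 k).trans_le (min_le_left _ _))
  · have hmono : pastSigma (coord : ℝ≥0 → JumpPath (Fin p ⊕ Unit) → _) s ≤
        pastSigma coord (denseSeq ℝ≥0 (n k)) :=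
      iSup_le fun u => iSup_le fun hus => 
        le_iSup_of_le u (le_iSup_of_le (hus.trans (hn1 k).le) le_rfl)
    exact hmono A hA

end Disintegration

section Conditional

variable {p : ℕ} {π : Fin p → ℝ} {T : ℝ → Matrix (Fin p) (Fin p) ℝ}
  {L : Measure (JumpPath (Fin p ⊕ Unit))}

/-- `K` is the Doob transform of the path law `L` by the density of absorption at time `x`: on the
past of each `s < x`, its density with respect to `L` is `absorbDensity T x s` at the state at time
`s`, divided by `iphDensity π T x`. -/
def IsDoobLaw (π : Fin p → ℝ) (T : ℝ → Matrix (Fin p) (Fin p) ℝ)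
    (L K : Measure (JumpPath (Fin p ⊕ Unit))) (x : ℝ) : Prop :=
  ∀ s : ℝ≥0, s < x → ∀ A, MeasurableSet[pastSigma coord s] A → ∀ i,
    ENNReal.ofReal (iphDensity π T x) * K (A ∩ coord s ⁻¹' {Sum.inl i}) =
      ENNReal.ofReal (absorbDensity T x s i) * L (A ∩ coord s ⁻¹' {Sum.inl i})

namespace IsDoobLaw

variable {K : Measure (JumpPath (Fin p ⊕ Unit))} {x : ℝ≥0}

theorem measureReal_eq (h : IsDoobLaw π T L K x) (hT : IsSubIntensity T)
    (hf : 0 < iphDensity π T x) {s : ℝ≥0} (hs : s < x) {A : Set (JumpPath (Fin p ⊕ Unit))}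
    (hA : MeasurableSet[pastSigma coord s] A) (i : Fin p) :
    K.real (A ∩ coord s ⁻¹' {Sum.inl i}) =
      absorbDensity T x s i * L.real (A ∩ coord s ⁻¹' {Sum.inl i}) / iphDensity π T x := by
  have h1 := congrArg ENNReal.toReal (h s (NNReal.coe_lt_coe.2 hs) A hA i)
  rw [ENNReal.toReal_mul, ENNReal.toReal_mul, ENNReal.toReal_ofReal hf.le, ENNReal.toReal_ofReal
    (absorbDensity_nonneg hT s.coe_nonneg (NNReal.coe_le_coe.2 hs.le) i)] at h1
  rw [eq_div_iff hf.ne', measureReal_def, measureReal_def, ← h1, mul_comm]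

variable [IsProbabilityMeasure K]

/-- The Markov property of the Doob transform, for events of the past. -/
theorem measureReal_inter (h : IsDoobLaw π T L K x) (hL : IsPathLaw π T L) (hT : IsSubIntensity T)
    (hf : 0 < iphDensity π T x) {s t : ℝ≥0} (hst : s ≤ t) (ht : t < x)
    {A : Set (JumpPath (Fin p ⊕ Unit))} (hA : MeasurableSet[pastSigma coord s] A) (i j : Fin p) :
    K.real (A ∩ coord s ⁻¹' {Sum.inl i} ∩ coord t ⁻¹' {Sum.inl j}) =
      K.real (A ∩ coord s ⁻¹' {Sum.inl i}) * condTransition T x s t i j := by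
  have hmono : pastSigma (coord : ℝ≥0 → JumpPath (Fin p ⊕ Unit) → _) s ≤ pastSigma coord t :=
    iSup_le fun u => iSup_le fun hus => le_iSup_of_le u (le_iSup_of_le (hus.trans hst) le_rfl)
  have hAt : MeasurableSet[pastSigma coord t] (A ∩ coord s ⁻¹' {Sum.inl i}) :=
    (hmono A hA).inter (measurable_coord_pastSigma hst (MeasurableSet.singleton _))
  by_cases h0 : absorbDensity T x s i = 0
  · -- a state that is impossible at time `s` has probability zero
    have hz : K.real (A ∩ coord s ⁻¹' {Sum.inl i}) = 0 := by
      rw [h.measureReal_eq hT hf (hst.trans_lt ht) hA, h0, zero_mul, zero_div]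
    rw [hz, zero_mul]
    exact le_antisymm (hz ▸ measureReal_mono inter_subset_left) measureReal_nonneg
  · rw [h.measureReal_eq hT hf ht hAt, h.measureReal_eq hT hf (hst.trans_lt ht) hA,
      hL.markov s t hst A hA, prodIntegral_fullIntensity_inl_inl hT s.coe_nonneg
      (NNReal.coe_le_coe.2 hst), condTransition, Matrix.of_apply]
    field_simp

theorem ae_mem_possibleStates (h : IsDoobLaw π T L K x) (hT : IsSubIntensity T)
    (hf : 0 < iphDensity π T x) (hτ : ∀ᵐ f ∂K, absorptionTime coord f = x) {t : ℝ≥0} (ht : t < x) :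
    ∀ᵐ f ∂K, ∃ i ∈ possibleStates T x t, coord t f = Sum.inl i := by
  have h1 : ∀ᵐ f ∂K, ∀ i, absorbDensity T x t i = 0 → coord t f ≠ Sum.inl i := by
    refine ae_all_iff.2 fun i => ?_
    by_cases h0 : absorbDensity T x t i = 0
    · have hz := h.measureReal_eq hT hf ht MeasurableSet.univ i
      rw [h0, zero_mul, zero_div, univ_inter, measureReal_eq_zero_iff] at hz
      simp only [h0, forall_const, ae_iff, not_not]
      exact hz
    · exact ae_of_all _ fun f hi => absurd hi h0
  filter_upwards [h1, hτ] with f hf1 hf2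
  have hne := ne_of_lt_absorptionTime (f := f) (t := t) (by rw [hf2]; exact_mod_cast ht)
  rcases hc : coord t f with i | i
  · exact ⟨i, (absorbDensity_nonneg hT t.coe_nonneg (NNReal.coe_le_coe.2 ht.le) i).lt_of_ne'
      fun h0 => hf1 i h0 hc, rfl⟩
  · exact absurd hc hne

theorem isMarkovJumpProcess (h : IsDoobLaw π T L K x) (hL : IsPathLaw π T L)
    (hT : IsSubIntensity T) (hx : 0 < x) (hf : 0 < iphDensity π T x)
    (hτ : ∀ᵐ f ∂K, absorptionTime coord f = x) :
    IsMarkovJumpProcess K x coord Sum.inl (condInitial π T x) (condTransition T x) where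
  measurable t _ := measurable_coord t
  paths f t _ := f.2 t ENNReal.coe_lt_top
  states := by
    filter_upwards [hτ] with f hfx t ht
    rcases hc : coord t f with i | i
    · exact mem_range_self i
    · exact absurd hc (ne_of_lt_absorptionTime (by rwa [hfx]))
  initial i := by
    have h1 := h.measureReal_eq hT hf hx MeasurableSet.univ i
    rw [univ_inter, hL.initial_inl] at h1
    rw [condInitial, mul_comm]
    exact h1
  markov s t hst htx j := by
    have ht : t < x := ENNReal.coe_lt_coe.1 htx
    have hm := pastSigma_coord_le (E := Fin p ⊕ Unit) s
    have hset : ∀ (u : ℝ≥0) (a : Fin p ⊕ Unit), {f : JumpPath (Fin p ⊕ Unit) | coord u f = a} =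
      coord u ⁻¹' {a} := fun _ _ => rfl
    simp only [hset]
    refine (ae_eq_condExp_of_forall_setIntegral_eq hm
      ((integrable_const (1 : ℝ)).indicator (measurableSet_coord_preimage t _)) (fun A _ _ => ?_)
      (fun A hA _ => ?_) ?_).symm
    · exact (integrable_finsetSum _ fun i _ =>
        (integrable_const _).indicator (measurableSet_coord_preimage s _)).integrableOn
    · have hAm := hm A hA
      have hint : ∀ i ∈ Finset.univ, Integrable ((coord s ⁻¹' {Sum.inl i}).indicator
          fun _ => condTransition T x s t i j) (K.restrict A) := fun i _ =>
        (integrable_const _).indicator (measurableSet_coord_preimage s _)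
      rw [integral_finsetSum _ hint]
      simp only [integral_indicator (measurableSet_coord_preimage _ _), integral_const,
        Measure.restrict_restrict (measurableSet_coord_preimage _ _), smul_eq_mul, mul_one,
        measureReal_restrict_apply_univ]
      simp only [inter_comm _ A]
      simp only [← h.measureReal_inter hL hT hf hst ht hA]
      have hsum := sum_measure_inter_coord K s (A ∩ coord t ⁻¹' {Sum.inl j})
      have hnull : K (coord s ⁻¹' {Sum.inr ()} ∩ (A ∩ coord t ⁻¹' {Sum.inl j})) = 0 := by
        refine measure_mono_null inter_subset_left ?_
        have : ∀ᵐ f ∂K, coord s f ≠ Sum.inr () := by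
          filter_upwards [hτ] with f hfx
          refine ne_of_lt_absorptionTime ?_
          rw [hfx]
          exact ENNReal.coe_lt_coe.2 (hst.trans_lt ht)
        simpa only [ae_iff, not_not] using! this
      rw [Fintype.sum_sum_type] at hsum
      simp only [Finset.univ_unique, PUnit.default_eq_unit, Finset.sum_singleton, hnull,
        add_zero] at hsum
      rw [measureReal_def, ← hsum, ENNReal.toReal_sum fun _ _ => measure_ne_top _ _]
      refine Finset.sum_congr rfl fun i _ => ?_
      rw [measureReal_def]
      congr 2
      ext f
      simp only [mem_inter_iff]
      tauto
    · refine (Finset.stronglyMeasurable_fun_sum _ fun i _ => ?_).aestronglyMeasurable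
      exact stronglyMeasurable_const.indicator
        (measurable_coord_pastSigma le_rfl (MeasurableSet.singleton _))

end IsDoobLaw

end Conditional

/-! ### The conditional law of the path -/

section ConditionalLaw

theorem exists_isRegularCondDistrib {Ω : Type*} [MeasurableSpace Ω] (P : Measure Ω)
    [IsProbabilityMeasure P] {A B : Type*} [MeasurableSpace A] [MeasurableSpace B]
    [StandardBorelSpace B] [Nonempty B] {Z : Ω → B} (hZ : Measurable Z) (Y : Ω → A) :
    ∃ κ : Kernel A B, IsRegularCondDistrib P Z Y κ :=
  ⟨condDistrib Z Y P, inferInstance, (compProd_map_condDistrib hZ.aemeasurable).symm⟩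

variable {Ω : Type*} [MeasurableSpace Ω] {P : Measure Ω} {p : ℕ}
  {π : Fin p → ℝ} {T : ℝ → Matrix (Fin p) (Fin p) ℝ} {X : ℝ≥0 → Ω → Fin p ⊕ Unit}
  {Q : ℝ → ℝ → Matrix (Fin p ⊕ Unit) (Fin p ⊕ Unit) ℝ}

namespace IsMarkovJumpProcess

/-- The path of the process. -/
def path (hX : IsMarkovJumpProcess P ⊤ X id (Sum.elim π fun _ => 0) Q) (ω : Ω) :
    JumpPath (Fin p ⊕ Unit) :=
  ⟨fun t => X t ω, hX.paths ω⟩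

theorem measurable_path (hX : IsMarkovJumpProcess P ⊤ X id (Sum.elim π fun _ => 0) Q) :
    Measurable hX.path :=
  (measurable_pi_lambda _ fun t => hX.measurable t ENNReal.coe_lt_top).subtype_mk

theorem map_absorptionTime_prod
    (hX : IsMarkovJumpProcess P ⊤ X id (Sum.elim π fun _ => 0) Q)
    {κ : Kernel ℝ≥0∞ (JumpPath (Fin p ⊕ Unit))}
    (hκ : IsRegularCondDistrib P hX.path (absorptionTime X) κ) :
    (P.map hX.path).map (fun f => (absorptionTime coord f, f)) =
      ((P.map hX.path).map (absorptionTime coord)) ⊗ₘ κ := by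
  rw [Measure.map_map (measurable_absorptionTime.prodMk measurable_id') hX.measurable_path,
    Measure.map_map measurable_absorptionTime hX.measurable_path]
  exact hκ.2

variable [IsProbabilityMeasure P]

/-- Integrating the conditional expectations of the Markov property over events of the past. -/
theorem isPathLaw (hX : IsMarkovJumpProcess P ⊤ X id (Sum.elim π fun _ => 0)
    (prodIntegral (fullIntensity T))) : IsPathLaw π T (P.map hX.path) where
  initial_inl i := by
    rw [map_measureReal_apply hX.measurable_path (measurableSet_coord_preimage 0 _)]
    exact hX.initial (Sum.inl i)
  initial_inr := by
    have h := hX.initial (Sum.inr ())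
    rw [Sum.elim_inr, measureReal_eq_zero_iff] at h
    rw [Measure.map_apply hX.measurable_path (measurableSet_coord_preimage 0 _)]
    exact h
  markov s t hst A hA a b := by
    have hm : pastSigma X s ≤ ‹MeasurableSpace Ω› :=
      iSup_le fun u => iSup_le fun _ => (hX.measurable u ENNReal.coe_lt_top).comap_le
    have hXm : ∀ u : ℝ≥0, ∀ c, MeasurableSet {ω | X u ω = c} := fun u c =>
      hX.measurable u ENNReal.coe_lt_top (MeasurableSet.singleton c)
    have hXs : ∀ c, MeasurableSet[pastSigma X s] {ω | X s ω = c} := fun c =>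
      (Measurable.of_comap_le (le_iSup_of_le s (le_iSup_of_le le_rfl le_rfl)) :
        Measurable[pastSigma X s] (X s)) (MeasurableSet.singleton c)
    have hpath : pastSigma coord s ≤ (pastSigma X s).map hX.path := by
      refine iSup_le fun u => iSup_le fun hus => ?_
      rintro _ ⟨D, hD, rfl⟩
      exact (Measurable.of_comap_le (le_iSup_of_le u (le_iSup_of_le hus le_rfl)) :
        Measurable[pastSigma X s] (X u)) hD
    set A' := hX.path ⁻¹' A
    have hA' : MeasurableSet[pastSigma X s] A' := hpath A hA
    have hG : MeasurableSet[pastSigma X s] (A' ∩ {ω | X s ω = a}) := hA'.inter (hXs a)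
    have hAm := pastSigma_coord_le s A hA
    rw [map_measureReal_apply hX.measurable_path
      ((hAm.inter (measurableSet_coord_preimage s _)).inter (measurableSet_coord_preimage t _)),
      map_measureReal_apply hX.measurable_path (hAm.inter (measurableSet_coord_preimage s _))]
    change P.real (A' ∩ {ω | X s ω = a} ∩ {ω | X t ω = b}) = P.real (A' ∩ {ω | X s ω = a}) * _
    have hint : Integrable ({ω | X t ω = b}.indicator fun _ => (1 : ℝ)) P :=
      (integrable_const (1 : ℝ)).indicator (hXm t b)
    have h1 := setIntegral_condExp hm hint hG
    rw [setIntegral_congr_ae (g := fun _ => prodIntegral (fullIntensity T) s t a b) (hm _ hG) ?_,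
      setIntegral_const, integral_indicator (hXm t b), Measure.restrict_restrict (hXm t b),
      setIntegral_const, smul_eq_mul, smul_eq_mul, mul_one,
      inter_comm {ω | X t ω = b}] at h1
    · exact h1.symm
    · filter_upwards [hX.markov s t hst ENNReal.coe_lt_top b] with ω hω hmem
      have hsa : X s ω = a := hmem.2
      simp only [id] at hω
      rw [hω, Finset.sum_eq_single a]
      · exact indicator_of_mem (s := {ω | X s ω = a}) hsa _
      · exact fun c _ hc => indicator_of_notMem (s := {ω | X s ω = c})
          (fun h => hc (h.symm.trans hsa)) _
      · simp

theorem ae_isMarkovJumpProcess (hT : IsSubIntensity T)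
    (hX : IsMarkovJumpProcess P ⊤ X id (Sum.elim π fun _ => 0) (prodIntegral (fullIntensity T)))
    {κ : Kernel ℝ≥0∞ (JumpPath (Fin p ⊕ Unit))}
    (hκ : IsRegularCondDistrib P hX.path (absorptionTime X) κ) :
    ∀ᵐ x ∂(P.map (absorptionTime X)), x ≠ ⊤ → 0 < x ∧ 0 < iphDensity π T x.toReal ∧
      IsMarkovJumpProcess (κ x) x coord Sum.inl (condInitial π T x.toReal)
        (condTransition T x.toReal) ∧
      ∀ t : ℝ≥0, (t : ℝ≥0∞) < x →
        ∀ᵐ f ∂(κ x), ∃ i ∈ possibleStates T x.toReal t, coord t f = Sum.inl i := by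
  have hκm : IsMarkovKernel κ := hκ.1
  have hprob : IsProbabilityMeasure (P.map hX.path) :=
    Measure.isProbabilityMeasure_map hX.measurable_path.aemeasurable
  have hL := hX.isPathLaw
  have hκ' := hX.map_absorptionTime_prod hκ
  have hlaw : P.map (absorptionTime X) = (P.map hX.path).map (absorptionTime coord) := by
    rw [Measure.map_map measurable_absorptionTime hX.measurable_path]
    rfl
  rw [hlaw]
  set L := P.map hX.path
  -- under the conditional law, the absorption time is the given one
  have h1 : ∀ᵐ x ∂(L.map (absorptionTime coord)), ∀ᵐ f ∂(κ x), absorptionTime coord f = x := by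
    refine Measure.ae_ae_of_ae_compProd
      (p := fun q : ℝ≥0∞ × JumpPath (Fin p ⊕ Unit) => absorptionTime coord q.2 = q.1) ?_
    rw [← hκ']
    refine (ae_map_iff (measurable_absorptionTime.prodMk measurable_id').aemeasurable ?_).2
      (ae_of_all _ fun f => rfl)
    exact measurableSet_eq_fun (measurable_absorptionTime.comp measurable_snd) measurable_fst
  -- properties of almost every time, for the absolutely continuous law of the finite times
  have h2 : ∀ᵐ x ∂(absorbedLaw L univ), 0 < x ∧ 0 < iphDensity π T x ∧
      IsDoobLaw π T L (κ (ENNReal.ofReal x)) x := by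
    have hd := aemeasurable_absorbedDensity hT hL.initial_nonneg
    rw [hL.absorbedLaw_univ hT, ae_withDensity_iff' hd]
    filter_upwards [ae_density_mul_kernel hL hT hκ'] with x hx hne
    have hx0 : 0 < x := by
      by_contra h0
      exact hne (indicator_of_notMem (by simpa using h0) _)
    rw [absorbedDensity, indicator_of_mem (mem_Ioi.2 hx0)] at hne
    exact ⟨hx0, ENNReal.ofReal_pos.1 (pos_iff_ne_zero.2 hne), hx⟩
  have htop : MeasurableSet ({⊤}ᶜ : Set ℝ≥0∞) := (MeasurableSet.singleton ⊤).compl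
  have hmap : absorbedLaw L univ =
      ((L.map (absorptionTime coord)).restrict {⊤}ᶜ).map ENNReal.toReal := by
    rw [Measure.restrict_map measurable_absorptionTime htop,
      Measure.map_map ENNReal.measurable_toReal measurable_absorptionTime, absorbedLaw, univ_inter]
    rfl
  rw [hmap] at h2
  have h3 := (ae_restrict_iff' htop).1 (ae_of_ae_map ENNReal.measurable_toReal.aemeasurable h2)
  filter_upwards [h1, h3] with x hτ hx hxt
  obtain ⟨hx0, hf, hd⟩ := hx hxt
  lift x to ℝ≥0 using hxt
  rw [ENNReal.coe_toReal] at hx0 hf hd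
  rw [ENNReal.ofReal_coe_nnreal] at hd
  have hx0' : 0 < x := NNReal.coe_pos.1 hx0
  refine ⟨ENNReal.coe_pos.2 hx0', hf, hd.isMarkovJumpProcess hL hT hx0' hf hτ, fun t ht => ?_⟩
  exact hd.ae_mem_possibleStates hT hf hτ (ENNReal.coe_lt_coe.1 ht)

end IsMarkovJumpProcess

end ConditionalLaw

end IPH

theorem mainTheorem2 {Ω : Type*} [MeasurableSpace Ω] (P : Measure Ω) [IsProbabilityMeasure P]
    (p : ℕ) (π : Fin p → ℝ) (T : ℝ → Matrix (Fin p) (Fin p) ℝ) (hT : IPH.IsSubIntensity T)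
    (X : ℝ≥0 → Ω → Fin p ⊕ Unit)
    (hX : IPH.IsMarkovJumpProcess P ⊤ X id (Sum.elim π fun _ => 0)
      (IPH.prodIntegral (IPH.fullIntensity T))) :
    -- the conditional law of the path of `X` given the absorption time exists
    (∃ κ : Kernel ℝ≥0∞ (IPH.JumpPath (Fin p ⊕ Unit)),
      IPH.IsRegularCondDistrib P (fun ω => (⟨fun t => X t ω, hX.paths ω⟩ : IPH.JumpPath _))
        (IPH.absorptionTime X) κ) ∧
    -- under it, the path before absorption is a Markov jump process on the transient states
    (∀ κ : Kernel ℝ≥0∞ (IPH.JumpPath (Fin p ⊕ Unit)),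
      IPH.IsRegularCondDistrib P (fun ω => (⟨fun t => X t ω, hX.paths ω⟩ : IPH.JumpPath _))
        (IPH.absorptionTime X) κ →
      ∀ᵐ x ∂(P.map (IPH.absorptionTime X)), x ≠ ⊤ →
        0 < x ∧ 0 < IPH.iphDensity π T x.toReal ∧
        IPH.IsMarkovJumpProcess (κ x) x IPH.coord Sum.inl
          (IPH.condInitial π T x.toReal) (IPH.condTransition T x.toReal) ∧
        ∀ t : ℝ≥0, (t : ℝ≥0∞) < x →
          ∀ᵐ f ∂(κ x), ∃ i ∈ IPH.possibleStates T x.toReal t, IPH.coord t f = Sum.inl i) ∧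
    -- its transition function has the conditional intensities
    (∀ x : ℝ, 0 < x →
      IPH.IsTransitionFunction x (IPH.possibleStates T x)
        (IPH.condTransition T x) (IPH.condIntensity T x) ∧
      (∀ᵐ t : ℝ, 0 ≤ t → t < x → ∀ i ∈ IPH.possibleStates T x t, ∀ j,
        IPH.HasTransitionRate (IPH.condTransition T x) t i j (IPH.condIntensity T x t i j)) ∧
      (∀ t : ℝ, 0 ≤ t → t < x →
        (∀ k l, ContinuousWithinAt (fun u => T u k l) (Ici t) t) →
        ∀ i ∈ IPH.possibleStates T x t, ∀ j,
        IPH.HasTransitionRate (IPH.condTransition T x) t i j (IPH.condIntensity T x t i j))) := by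
  refine ⟨IPH.exists_isRegularCondDistrib P hX.measurable_path _,
    fun κ hκ => hX.ae_isMarkovJumpProcess hT hκ, fun x _ =>
    ⟨IPH.isTransitionFunction_condTransition hT, IPH.ae_hasTransitionRate_condTransition hT x,
      fun t ht htx hc i hi j =>
        IPH.hasTransitionRate_condTransition_of_continuousWithinAt hT ht htx hc hi j⟩⟩
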